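/- Conventions. Fix $N\in\mathbb N$ and $1\le p<\infty$; $|\cdot|$ is the Euclidean norm of $\mathbb R^N$, $B_j\subset\mathbb R^N$ the closed ball of radius $j$ about $0$, and $Y=\mathbb R^N$ or $Y=\mathbb R^{N\times N}$ (linear maps of $\mathbb R^N$, with the operator norm, written $|\cdot|$ too). $L^p_{loc}$ is the set of functions $\mathbb R\to\mathbb R$ that are in $L^p$ on every compact interval. Consider the following conditions on $f:\mathbb R\times\mathbb R^N\to Y$: - (C1) $f$ is Borel measurable; - (C2) for every compact $K\subset\mathbb R^N$ there is $m^K\in L^p_{loc}$ such that for a.e. $t\in\mathbb R$, $|f(t,x)|\le m^K(t)$ for all $x\in K$; - (L) for every compact $K\subset\mathbb R^N$ there is $l^K\in L^p_{loc}$ such that for a.e. $t\in\mathbb R$, $|f(t,x)-f(t,y)|\le l^K(t)|x-y|$ for all $x,y\in K$. $\mathfrak{LC}_p$ is the set of $f:\mathbb R\times\mathbb R^N\to\mathbb R^N$ satisfying (C1), (C2), (L). For such $f$ put $m_f^j(t)=\sup_{x\in B_j}|f(t,x)|$. A set $E\subset\mathfrak{LC}_p$ has $L^1_{loc}$-equicontinuous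 $m$-bounds if for all $j\in\mathbb N$, $r>0$, $\varepsilon>0$ there is $\delta>0$ with $\sup_{f\in E}\int_s^t m_f^j(u)\,du<\varepsilon$ whenever $-r\le s\le t\le r$ and $t-s<\delta$. In this case let $\Theta=\{\theta^I_j\}$, where $j\in\mathbb N$, $I=[q_1,q_2]$ with $q_1\le q_2$ rational, and $$\theta_j^I(s)=\sup_{t\in I,\ f\in E}\int_t^{t+s}m_f^j(u)\,du,\qquad s\ge 0 .$$ Each $\theta_j^I$ is a finite, continuous, non-decreasing function with $\theta^I_j(0)=0$. Let $\mathcal K_j^I$ be the set of continuous $x:I\to B_j$ with $|x(s)-x(t)|\le\theta_j^I(|s-t|)$ for all $s,t\in I$. $\Theta\mathfrak C_p(Y)$ is the set of $f:\mathbb R\times\mathbb R^N\to Y$ satisfying (C1), (C2) and, for all $j$ and $I$, - (T) if $x_n\in\mathcal K_j^I$ converge uniformly to $x\in\mathcal K_j^I$, then $\int_I|f(t,x_n(t))-f(t,x(t))|^p\,dt\to0$. $\mathcal T_\Theta$ is the topology on $\Theta\mathfrak C_p(Y)$, and on $\mathfrak{LC}_p$, generated by the seminorms $$p_{I,j}(f)=\sup_{x\in\mathcal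 K_j^I}\Big[\int_I|f(t,x(t))|^p\,dt\Big]^{1/p}.$$ For $f\in\mathfrak{LC}_p$ and $x_0\in\mathbb R^N$, $x(\cdot,f,x_0)$ is the unique maximal Carathéodory solution of $\dot x=f(t,x)$, $x(0)=x_0$, and $I_{f,x_0}$ is its (open) maximal interval of existence. For moreover $F\in\Theta\mathfrak C_p(\mathbb R^{N\times N})$, $h\in\Theta\mathfrak C_p(\mathbb R^N)$, $y_0\in\mathbb R^N$, the pair $(x(\cdot,f,x_0),y(\cdot,f,F,h,x_0,y_0))$ is the unique maximal solution of $$\dot x=f(t,x),\ x(0)=x_0,\qquad \dot y=F(t,x)\,y+h(t,x),\ y(0)=y_0 ,$$ which is also defined on $I_{f,x_0}$. Theorem. Let $E\subset\mathfrak{LC}_p$ have $L^1_{loc}$-equicontinuous $m$-bounds and let $\Theta$ be as above. Let $(f_n)$ be a sequence in $E$ converging to $f$ in $(\mathfrak{LC}_p,\mathcal T_\Theta)$ and let $x_{0,n}\to x_0$ in $\mathbb R^N$. (i) For every $[T_1,T_2]\subset I_{f,x_0}$ one has $[T_1,T_2]\subset I_{f_n,x_{0,n}}$ for all large $n$, and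 $x(\cdot,f_n,x_{0,n})\to x(\cdot,f,x_0)$ uniformly on $[T_1,T_2]$. (ii) If moreover $F_n\to F$ in $(\Theta\mathfrak C_p(\mathbb R^{N\times N}),\mathcal T_\Theta)$, $h_n\to h$ in $(\Theta\mathfrak C_p(\mathbb R^N),\mathcal T_\Theta)$ and $y_{0,n}\to y_0$ in $\mathbb R^N$, then for every $[T_1,T_2]\subset I_{f,x_0}$ the solution of the limit system and, for all large $n$, the solutions of the $n$-th systems are defined on $[T_1,T_2]$, and $y(\cdot,f_n,F_n,h_n,x_{0,n},y_{0,n})\to y(\cdot,f,F,h,x_0,y_0)$ uniformly on $[T_1,T_2]$. -/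

import Mathlib

open Set Filter Topology MeasureTheory
open scoped NNReal ENNReal

namespace Caratheodory

/-- Euclidean space of dimension `N`. -/
abbrev V (N : ℕ) := EuclideanSpace ℝ (Fin N)

/-- `m` is locally of class `L^p` on the line: it is in `L^p` on every compact interval. -/
def IsLpLoc (p : ℝ) (m : ℝ → ℝ) : Prop :=
  ∀ a b : ℝ, MemLp m (ENNReal.ofReal p) (volume.restrict (Icc a b))

/-- Conditions (C1) and (C2): Borel measurability and existence of `m`-bounds on compact sets. -/
structure IsC {N : ℕ} {Y : Type*} [NormedAddCommGroup Y] [MeasurableSpace Y]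
    (p : ℝ) (f : ℝ → V N → Y) : Prop where
  measurable : Measurable (Function.uncurry f)
  mBound : ∀ K : Set (V N), IsCompact K →
    ∃ m : ℝ → ℝ, IsLpLoc p m ∧ ∀ᵐ t : ℝ, ∀ x ∈ K, ‖f t x‖ ≤ m t

/-- The Lipschitz Carathéodory functions: (C1), (C2) and existence of `l`-bounds. -/
def LC (p : ℝ) (N : ℕ) (Y : Type*) [NormedAddCommGroup Y] [MeasurableSpace Y] :
    Set (ℝ → V N → Y) :=
  {f | IsC p f ∧ ∀ K : Set (V N), IsCompact K →
    ∃ l : ℝ → ℝ, IsLpLoc p l ∧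
      ∀ᵐ t : ℝ, ∀ x ∈ K, ∀ y ∈ K, ‖f t x - f t y‖ ≤ l t * ‖x - y‖}

/-- A suitable set of moduli of continuity: `θ j q₁ q₂` is the modulus attached to the radius `j`
and to the interval `[q₁, q₂]`. -/
structure Moduli where
  θ : ℕ → ℚ → ℚ → ℝ≥0 → ℝ≥0
  continuous' : ∀ j q₁ q₂, Continuous (θ j q₁ q₂)
  monotone' : ∀ j q₁ q₂, Monotone (θ j q₁ q₂)
  zero' : ∀ j q₁ q₂, θ j q₁ q₂ 0 = 0
  order' : ∀ (j k : ℕ) (q₁ q₂ r₁ r₂ : ℚ), j ≤ k → r₁ ≤ q₁ → q₁ ≤ q₂ → q₂ ≤ r₂ →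
    ∀ s, θ j q₁ q₂ s ≤ θ k r₁ r₂ s

/-- The set `K_j^I`, `I = [q₁, q₂]`: continuous functions from `I` to the closed ball of radius `j`
with modulus of continuity `θ_j^I`. A function on `I` is represented by a function on `ℝ`, of which
only the values on `I` are ever used. -/
def KSet {N : ℕ} (Θ : Moduli) (j : ℕ) (q₁ q₂ : ℚ) : Set (ℝ → V N) :=
  {x | ContinuousOn x (Icc (q₁ : ℝ) q₂) ∧
    (∀ t ∈ Icc (q₁ : ℝ) q₂, x t ∈ Metric.closedBall (0 : V N) j) ∧
    ∀ s ∈ Icc (q₁ : ℝ) q₂, ∀ t ∈ Icc (q₁ : ℝ) q₂, nndist (x s) (x t) ≤ Θ.θ j q₁ q₂ (nndist s t)}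

/-- The `Θ`-Carathéodory functions: (C1), (C2) and (T). -/
def ThetaC (p : ℝ) (Θ : Moduli) (N : ℕ) (Y : Type*) [NormedAddCommGroup Y] [MeasurableSpace Y] :
    Set (ℝ → V N → Y) :=
  {f | IsC p f ∧ ∀ (j : ℕ) (q₁ q₂ : ℚ), q₁ ≤ q₂ →
    ∀ (xs : ℕ → ℝ → V N) (x : ℝ → V N), (∀ n, xs n ∈ KSet Θ j q₁ q₂) → x ∈ KSet Θ j q₁ q₂ →
      TendstoUniformlyOn xs x atTop (Icc (q₁ : ℝ) q₂) →
      Tendsto (fun n => ∫⁻ t in Icc (q₁ : ℝ) q₂, ‖f t (xs n t) - f t (x t)‖ₑ ^ p) atTop (𝓝 0)}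

/-- The seminorm `p_{I,j}`, `I = [q₁, q₂]`, with values in `[0, ∞]`. -/
noncomputable def thetaSeminorm {N : ℕ} {Y : Type*} [NormedAddCommGroup Y]
    (p : ℝ) (Θ : Moduli) (j : ℕ) (q₁ q₂ : ℚ) (f : ℝ → V N → Y) : ℝ≥0∞ :=
  ⨆ x ∈ KSet (N := N) Θ j q₁ q₂, (∫⁻ t in Icc (q₁ : ℝ) q₂, ‖f t (x t)‖ₑ ^ p) ^ (1 / p)

/-- The topology `T_Θ` on a set `S` of functions (used for `S = ThetaC` and `S = LC`): the topology
generated by the seminorms `p_{I,j}`, that is by their open balls. -/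
@[reducible] def TTheta {N : ℕ} {Y : Type*} [NormedAddCommGroup Y] (p : ℝ) (Θ : Moduli)
    (S : Set (ℝ → V N → Y)) : TopologicalSpace S :=
  TopologicalSpace.generateFrom
    {U | ∃ (g : S) (j : ℕ) (q₁ q₂ : ℚ) (r : ℝ≥0∞), q₁ ≤ q₂ ∧ 0 < r ∧
      U = {f : S | thetaSeminorm p Θ j q₁ q₂ (f.1 - g.1) < r}}

/-- The optimal `m`-bound of `f` on the closed ball of radius `j`. -/
noncomputable def optMBound {N : ℕ} {Y : Type*} [NormedAddCommGroup Y]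
    (f : ℝ → V N → Y) (j : ℕ) (t : ℝ) : ℝ≥0∞ :=
  ⨆ x ∈ Metric.closedBall (0 : V N) j, ‖f t x‖ₑ

/-- `L^1_loc`-equicontinuity of a set of nonnegative functions. -/
def L1LocEquicontinuous (S : Set (ℝ → ℝ≥0∞)) : Prop :=
  ∀ r : ℝ, 0 < r → ∀ ε : ℝ, 0 < ε → ∃ δ : ℝ, 0 < δ ∧
    ∀ s t : ℝ, -r ≤ s → s ≤ t → t ≤ r → t - s < δ →
      (⨆ m ∈ S, ∫⁻ u in Icc s t, m u) < ENNReal.ofReal ε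

/-- `E` has `L^1_loc`-equicontinuous `m`-bounds. -/
def HasEquicontMBounds {N : ℕ} {Y : Type*} [NormedAddCommGroup Y]
    (E : Set (ℝ → V N → Y)) : Prop :=
  ∀ j : ℕ, L1LocEquicontinuous ((fun f => optMBound f j) '' E)

section moduliOfE

variable {N : ℕ} {Y : Type*} [NormedAddCommGroup Y]

/-- `sup_{t ∈ [q₁, q₂], f ∈ E} ∫_t^{t+s} m_f^j(u) du`, with values in `[0, ∞]`. -/
noncomputable def supModulus (E : Set (ℝ → V N → Y)) (j : ℕ) (q₁ q₂ : ℚ) (s : ℝ≥0) : ℝ≥0∞ :=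
  ⨆ t ∈ Icc (q₁ : ℝ) q₂, ⨆ f ∈ E, ∫⁻ u in Icc t (t + s), optMBound f j u

theorem supModulus_mono (E : Set (ℝ → V N → Y)) (j : ℕ) (q₁ q₂ : ℚ) :
    Monotone (supModulus E j q₁ q₂) := by
  intro s s' h
  refine iSup₂_mono fun t _ => iSup₂_mono fun f _ => lintegral_mono_set ?_
  exact Icc_subset_Icc le_rfl (by gcongr)

theorem supModulus_zero (E : Set (ℝ → V N → Y)) (j : ℕ) (q₁ q₂ : ℚ) :
    supModulus E j q₁ q₂ 0 = 0 := by
  simp [supModulus]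

theorem supModulus_order (E : Set (ℝ → V N → Y)) {j k : ℕ} {q₁ q₂ r₁ r₂ : ℚ} (hjk : j ≤ k)
    (h₁ : r₁ ≤ q₁) (h₂ : q₂ ≤ r₂) (s : ℝ≥0) :
    supModulus E j q₁ q₂ s ≤ supModulus E k r₁ r₂ s := by
  refine iSup₂_le fun t ht => iSup₂_le fun f hf => ?_
  have ht' : t ∈ Icc (r₁ : ℝ) r₂ :=
    ⟨le_trans (by exact_mod_cast h₁) ht.1, ht.2.trans (by exact_mod_cast h₂)⟩
  refine le_trans (lintegral_mono fun u => ?_)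
    (le_iSup₂_of_le t ht' (le_iSup₂_of_le f hf le_rfl))
  refine iSup₂_le fun x hx => le_iSup₂_of_le x ?_ le_rfl
  exact Metric.closedBall_subset_closedBall (by exact_mod_cast hjk) hx

theorem supModulus_step {E : Set (ℝ → V N → Y)} (hE : HasEquicontMBounds E) (j : ℕ) (q₁ q₂ : ℚ)
    (S : ℝ≥0) (ε : ℝ) (hε : 0 < ε) : ∃ δ : ℝ, 0 < δ ∧ ∀ s s' : ℝ≥0, s ≤ s' → s' ≤ S →
      (s' : ℝ) - s < δ →
      supModulus E j q₁ q₂ s' ≤ supModulus E j q₁ q₂ s + ENNReal.ofReal ε := by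
  obtain ⟨δ, hδ, H⟩ := hE j (|(q₁ : ℝ)| + |(q₂ : ℝ)| + S + 1) (by positivity) ε hε
  refine ⟨δ, hδ, fun s s' hss hs' hd => iSup₂_le fun t ht => iSup₂_le fun f hf => ?_⟩
  have hss' : (s : ℝ) ≤ s' := by exact_mod_cast hss
  have hsS : (s' : ℝ) ≤ S := by exact_mod_cast hs'
  have hs0 := s.coe_nonneg
  have hS0 := S.coe_nonneg
  have e1 := neg_abs_le (q₁ : ℝ)
  have e2 := le_abs_self (q₂ : ℝ)
  have e3 := abs_nonneg (q₁ : ℝ)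
  have e4 := abs_nonneg (q₂ : ℝ)
  have ht1 := ht.1
  have ht2 := ht.2
  have H' := H (t + s) (t + s') (by linarith) (by linarith) (by linarith) (by linarith)
  rw [← Icc_union_Icc_eq_Icc (b := t + (s : ℝ)) (by linarith) (by linarith)]
  refine (lintegral_union_le _ _ _).trans (add_le_add ?_ ?_)
  · exact le_iSup₂_of_le t ht (le_iSup₂_of_le f hf le_rfl)
  · refine le_trans ?_ H'.le
    exact le_iSup₂_of_le (f := fun (m : ℝ → ℝ≥0∞) _ => ∫⁻ u in Icc (t + (s : ℝ)) (t + s'), m u)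
      (optMBound f j) (mem_image_of_mem _ hf) le_rfl

theorem supModulus_ne_top {E : Set (ℝ → V N → Y)} (hE : HasEquicontMBounds E) (j : ℕ) (q₁ q₂ : ℚ)
    (s : ℝ≥0) : supModulus E j q₁ q₂ s ≠ ⊤ := by
  obtain ⟨δ, hδ, H⟩ := supModulus_step hE j q₁ q₂ s 1 one_pos
  obtain ⟨n, hn⟩ := exists_nat_gt ((s : ℝ) / (δ / 2))
  have key : ∀ k : ℕ, supModulus E j q₁ q₂ (min (k * (δ / 2).toNNReal) s) ≤ k := by
    intro k
    induction k with
    | zero => simp [supModulus_zero]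
    | succ k ih =>
      refine (H (min (k * (δ / 2).toNNReal) s) _ (by gcongr; simp) (min_le_right _ _) ?_).trans ?_
      · have hc : ((δ / 2).toNNReal : ℝ) = δ / 2 := Real.coe_toNNReal _ (by positivity)
        push_cast
        rw [hc]
        rcases min_cases ((k : ℝ) * (δ / 2)) (s : ℝ) with h | h <;>
        rcases min_cases (((k : ℝ) + 1) * (δ / 2)) (s : ℝ) with h' | h' <;> nlinarith
      · push_cast
        simpa using ih
  have hle : s ≤ n * (δ / 2).toNNReal := by
    rw [div_lt_iff₀ (by positivity)] at hn
    rw [← NNReal.coe_le_coe]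
    push_cast
    rw [Real.coe_toNNReal _ (by positivity)]
    exact hn.le
  have := key n
  rw [min_eq_right hle] at this
  exact ne_top_of_le_ne_top (ENNReal.natCast_ne_top n) this

theorem supModulus_continuous {E : Set (ℝ → V N → Y)} (hE : HasEquicontMBounds E) (j : ℕ)
    (q₁ q₂ : ℚ) : Continuous fun s => (supModulus E j q₁ q₂ s).toNNReal := by
  have hcoe : ∀ s, (((supModulus E j q₁ q₂ s).toNNReal : ℝ≥0) : ℝ≥0∞) = supModulus E j q₁ q₂ s :=
    fun s => ENNReal.coe_toNNReal (supModulus_ne_top hE j q₁ q₂ s)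
  rw [Metric.continuous_iff]
  intro b ε hε
  obtain ⟨δ, hδ, H⟩ := supModulus_step hE j q₁ q₂ (b + 1) (ε / 2) (by positivity)
  have H' : ∀ s s' : ℝ≥0, s ≤ s' → s' ≤ b + 1 → (s' : ℝ) - s < δ →
      ((supModulus E j q₁ q₂ s').toNNReal : ℝ) ≤ (supModulus E j q₁ q₂ s).toNNReal + ε / 2 := by
    intro s s' h1 h2 h3
    have h := H s s' h1 h2 h3
    rw [← hcoe s, ← hcoe s', ENNReal.ofReal, ← ENNReal.coe_add, ENNReal.coe_le_coe,
      ← NNReal.coe_le_coe, NNReal.coe_add, Real.coe_toNNReal _ (by positivity)] at h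
    exact h
  have hm : ∀ s s' : ℝ≥0, s ≤ s' →
      ((supModulus E j q₁ q₂ s).toNNReal : ℝ) ≤ (supModulus E j q₁ q₂ s').toNNReal := by
    intro s s' h
    exact_mod_cast ENNReal.toNNReal_mono (supModulus_ne_top hE j q₁ q₂ s')
      (supModulus_mono E j q₁ q₂ h)
  refine ⟨min δ 1, by positivity, fun a ha => ?_⟩
  rw [NNReal.dist_eq, abs_lt] at ha
  have hd1 := min_le_left δ 1
  have hd2 := min_le_right δ 1
  rw [NNReal.dist_eq, abs_lt]
  rcases le_total a b with hab | hab
  · have h1 := H' a b hab (by simp) (by linarith)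
    have h2 := hm a b hab
    constructor <;> linarith
  · have hb : a ≤ b + 1 := by
      rw [← NNReal.coe_le_coe]
      push_cast
      linarith
    have h1 := H' b a hab hb (by linarith)
    have h2 := hm b a hab
    constructor <;> linarith

/-- The moduli of continuity built from the `m`-bounds of `E`:
`θ_j^I(s) = sup_{t ∈ I, f ∈ E} ∫_t^{t+s} m_f^j(u) du`. -/
noncomputable def moduliOf (E : Set (ℝ → V N → Y)) (hE : HasEquicontMBounds E) : Moduli where
  θ j q₁ q₂ s := (supModulus E j q₁ q₂ s).toNNReal
  continuous' := supModulus_continuous hE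
  monotone' j q₁ q₂ _ s' h :=
    ENNReal.toNNReal_mono (supModulus_ne_top hE j q₁ q₂ s') (supModulus_mono E j q₁ q₂ h)
  zero' j q₁ q₂ := by simp [supModulus_zero]
  order' _ k _ _ r₁ r₂ hjk h₁ _ h₂ s :=
    ENNReal.toNNReal_mono (supModulus_ne_top hE k r₁ r₂ s) (supModulus_order E hjk h₁ h₂ s)

end moduliOfE

section Cauchy

variable {X : Type*} [NormedAddCommGroup X] [NormedSpace ℝ X]

/-- `x` solves, in the sense of Carathéodory, `x' = g(t, x)`, `x(0) = x₀` on the open interval `J`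
containing `0`. -/
structure IsSolution (g : ℝ → X → X) (x₀ : X) (J : Set ℝ) (x : ℝ → X) : Prop where
  isOpen : IsOpen J
  ordConnected : J.OrdConnected
  zero_mem : (0 : ℝ) ∈ J
  continuousOn : ContinuousOn x J
  integrable : ∀ t ∈ J, IntervalIntegrable (fun s => g s (x s)) volume 0 t
  eq : ∀ t ∈ J, x t = x₀ + ∫ s in (0 : ℝ)..t, g s (x s)

/-- The maximal interval of existence: the union of all intervals that carry a solution. -/
def maxInterval (g : ℝ → X → X) (x₀ : X) : Set ℝ :=
  {t | ∃ (J : Set ℝ) (x : ℝ → X), IsSolution g x₀ J x ∧ t ∈ J}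

open Classical in
/-- The maximal solution `x(·, g, x₀)`: at `t` in the maximal interval it is the value at `t` of
the solutions whose interval contains `t` (all the same when solutions are unique). Outside the
maximal interval it is `0` and has no meaning. -/
noncomputable def solution (g : ℝ → X → X) (x₀ : X) (t : ℝ) : X :=
  if h : ∃ (x : ℝ → X) (J : Set ℝ), IsSolution g x₀ J x ∧ t ∈ J then h.choose t else 0

end Cauchy

/-- The right-hand side of the triangular system `x' = f(t, x)`, `y' = F(t, x) y + h(t, x)`.
An `N × N` matrix is a linear map of Euclidean space into itself. -/
def triangular {N : ℕ} (f : ℝ → V N → V N) (F : ℝ → V N → V N →L[ℝ] V N) (h : ℝ → V N → V N)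
    (t : ℝ) (z : V N × V N) : V N × V N :=
  (f t z.1, F t z.1 z.2 + h t z.1)

end Caratheodory

/-!
Continuous dependence rests on one stability estimate for integral equations,
`norm_sub_le_of_integral_eq`, fed with two sources of convergence.

*The nonlinear equation.* Let `x` be the limit solution on a rational interval `I` around `0`, with
values in the ball of radius `j - 1`, and let `P` be the projection onto the ball of radius `j`. The
truncated equation `w' = fₙ(t, P w)` is globally Lipschitz with an integrable coefficient, so that it
has a solution `wₙ` on all of `I` (`exists_solution_Icc`). As `P` is nonexpansive and `fₙ ∈ E`, the
curve `P wₙ` has the modulus of continuity `θ_j^I`, that is, `P wₙ ∈ K_j^I`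
(`radial_comp_mem_KSet`). Hence `∫_I |fₙ(t, P wₙ) - f(t, P wₙ)| dt` is dominated by the seminorm
`p_{I,j}(fₙ - f)` and tends to `0`, while `|f(t, P wₙ) - f(t, x)| ≤ l(t) |wₙ - x|` with the Lipschitz
coefficient `l` of `f` alone. Grönwall's inequality gives `wₙ → x` uniformly on `I`. For large `n` the
values of `wₙ` are then in the ball, the projection does nothing, and `wₙ` is the solution of the
original equation; in particular this solution exists on `I` (`exists_projected_solutions`).

*The linear equation.* The projected curves `zₙ = P wₙ` are in `K_j^I` for every `n` and converge
uniformly to `x`, which is therefore in `K_j^I` too. The seminorm and condition (T) give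
`Fₙ(t, zₙ) → F(t, x)` and `hₙ(t, zₙ) → h(t, x)` in `L^1(I)`
(`tendsto_integral_norm_sub_of_tendsto`), and linear equations depend continuously on `L^1`
coefficients (`tendstoUniformlyOn_linear`).

Both global existence and Grönwall's inequality come from the inequality
`|∫₀ᵗ l W| ≤ W(t) / 2` for the weight `W(t) = exp (2 |∫₀ᵗ l|)` (`abs_integral_mul_exp_le`), which
treats both directions of time at once.
-/

namespace Caratheodory

/-! ### Weighted estimates and Grönwall's inequality -/

theorem _root_.LipschitzOnWith.comp_absolutelyContinuousOnInterval {X Z : Type*}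
    [PseudoMetricSpace X] [PseudoMetricSpace Z] {g : X → Z} {K : ℝ≥0} {s : Set X} {f : ℝ → X}
    {a b : ℝ} (hg : LipschitzOnWith K g s) (hf : AbsolutelyContinuousOnInterval f a b)
    (hs : MapsTo f (uIcc a b) s) : AbsolutelyContinuousOnInterval (g ∘ f) a b := by
  rw [absolutelyContinuousOnInterval_iff] at hf ⊢
  intro ε hε
  obtain ⟨δ, hδ, H⟩ := hf (ε / (K + 1)) (by positivity)
  refine ⟨δ, hδ, fun I hI hIδ => ?_⟩
  calc ∑ i ∈ Finset.range I.1, dist (g (f (I.2 i).1)) (g (f (I.2 i).2))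
      ≤ ∑ i ∈ Finset.range I.1, K * dist (f (I.2 i).1) (f (I.2 i).2) :=
        Finset.sum_le_sum fun i hi =>
          hg.dist_le_mul _ (hs (hI.1 i hi).1) _ (hs (hI.1 i hi).2)
    _ = K * ∑ i ∈ Finset.range I.1, dist (f (I.2 i).1) (f (I.2 i).2) := by rw [Finset.mul_sum]
    _ ≤ K * (ε / (K + 1)) := by
        gcongr
        exact (H I hI hIδ).le
    _ < (K + 1) * (ε / (K + 1)) := by
        gcongr
        linarith
    _ = ε := by field_simp

/-- The fundamental theorem of calculus for `exp (c ∫₀ˢ l)`, which is absolutely continuous but, for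
`l` merely integrable, in general only almost everywhere differentiable. -/
theorem integral_mul_exp_primitive {l : ℝ → ℝ} (hl : Integrable l) (c t : ℝ) :
    ∫ s in (0 : ℝ)..t, c * l s * Real.exp (c * ∫ u in (0 : ℝ)..s, l u) =
      Real.exp (c * ∫ u in (0 : ℝ)..t, l u) - 1 := by
  have hac : AbsolutelyContinuousOnInterval (fun s => c * ∫ u in (0 : ℝ)..s, l u) 0 t :=
    (hl.intervalIntegrable.absolutelyContinuousOnInterval_intervalIntegral
      left_mem_uIcc).const_mul c
  obtain ⟨M, hM⟩ := hac.exists_bound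
  obtain ⟨K, hK⟩ := (Real.contDiff_exp (n := 1)).contDiffOn.exists_lipschitzOnWith
    (s := Icc (-M) M) (by simp) (convex_Icc _ _) isCompact_Icc
  have hE := hK.comp_absolutelyContinuousOnInterval hac
    (fun s hs => abs_le.1 (by simpa using hM s hs))
  have hI := hE.integral_deriv_eq_sub
  simp only [Function.comp_apply, intervalIntegral.integral_same, mul_zero, Real.exp_zero] at hI
  rw [← hI]
  apply intervalIntegral.integral_congr_ae
  filter_upwards [hl.intervalIntegrable (a := (0 : ℝ)) (b := t)|>.ae_hasDerivAt_integral] with s hs hst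
  have hd := ((hs (uIoc_subset_uIcc hst) 0 left_mem_uIcc).const_mul c).exp
  rw [show (Real.exp ∘ fun s => c * ∫ u in (0 : ℝ)..s, l u) =
    fun s => Real.exp (c * ∫ u in (0 : ℝ)..s, l u) from rfl, hd.deriv]
  ring

/-- The inequality that makes `exp (2 |∫₀ᵗ l|)` a weight for which integration against `l` is a
contraction with constant `1 / 2`, forwards and backwards in time. -/
theorem abs_integral_mul_exp_le {l : ℝ → ℝ} (hl : Integrable l) (hl0 : ∀ t, 0 ≤ l t) (t : ℝ) :
    |∫ s in (0 : ℝ)..t, l s * Real.exp (2 * |∫ u in (0 : ℝ)..s, l u|)| ≤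
      1 / 2 * Real.exp (2 * |∫ u in (0 : ℝ)..t, l u|) := by
  rcases le_total 0 t with ht | ht
  · have hpos : ∀ s, 0 ≤ s → |∫ u in (0 : ℝ)..s, l u| = ∫ u in (0 : ℝ)..s, l u := fun s hs =>
      abs_of_nonneg (intervalIntegral.integral_nonneg hs fun u _ => hl0 u)
    have h1 := integral_mul_exp_primitive hl 2 t
    have h2 : ∫ s in (0 : ℝ)..t, l s * Real.exp (2 * |∫ u in (0 : ℝ)..s, l u|) =
        (1 / 2) * ∫ s in (0 : ℝ)..t, 2 * l s * Real.exp (2 * ∫ u in (0 : ℝ)..s, l u) := by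
      rw [← intervalIntegral.integral_const_mul]
      refine intervalIntegral.integral_congr fun s hs => ?_
      rw [uIcc_of_le ht] at hs
      simp only [hpos s hs.1]
      ring
    rw [h2, h1, hpos t ht, abs_le]
    have := Real.one_le_exp (x := 2 * ∫ u in (0 : ℝ)..t, l u)
      (by have := abs_nonneg (∫ u in (0 : ℝ)..t, l u); rw [hpos t ht] at this; linarith)
    constructor <;> linarith
  · have hneg : ∀ s, s ≤ 0 → |∫ u in (0 : ℝ)..s, l u| = -∫ u in (0 : ℝ)..s, l u := fun s hs => by
      rw [intervalIntegral.integral_symm, abs_neg, neg_neg,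
        abs_of_nonneg (intervalIntegral.integral_nonneg hs fun u _ => hl0 u)]
    have h1 := integral_mul_exp_primitive hl (-2) t
    have h2 : ∫ s in (0 : ℝ)..t, l s * Real.exp (2 * |∫ u in (0 : ℝ)..s, l u|) =
        (-1 / 2) * ∫ s in (0 : ℝ)..t, -2 * l s * Real.exp (-2 * ∫ u in (0 : ℝ)..s, l u) := by
      rw [← intervalIntegral.integral_const_mul]
      refine intervalIntegral.integral_congr fun s hs => ?_
      rw [uIcc_of_ge ht] at hs
      simp only [hneg s hs.2, mul_neg, neg_mul]
      ring
    have h3 : -2 * ∫ u in (0 : ℝ)..t, l u = 2 * |∫ u in (0 : ℝ)..t, l u| := by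
      rw [hneg t ht]; ring
    rw [h2, h1, h3, abs_le]
    have := Real.one_le_exp (x := 2 * |∫ u in (0 : ℝ)..t, l u|) (by positivity)
    constructor <;> linarith

theorem abs_integral_le_integral {l : ℝ → ℝ} (hl : Integrable l) (hl0 : ∀ t, 0 ≤ l t) (t : ℝ) :
    |∫ u in (0 : ℝ)..t, l u| ≤ ∫ u, l u := by
  rw [← Real.norm_eq_abs, intervalIntegral.norm_intervalIntegral_eq]
  rw [Real.norm_of_nonneg (setIntegral_nonneg measurableSet_uIoc fun u _ => hl0 u)]
  exact setIntegral_le_integral hl (Eventually.of_forall hl0)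

theorem continuous_exp_abs_primitive {l : ℝ → ℝ} (hl : Integrable l) (c : ℝ) :
    Continuous fun t => Real.exp (c * |∫ u in (0 : ℝ)..t, l u|) := by
  have := intervalIntegral.continuous_primitive (μ := volume) (f := l)
    (fun a b => hl.intervalIntegrable) 0
  fun_prop

/-- **Grönwall's inequality** for an integrable kernel, on both sides of `0`. The constants are not
optimal. -/
theorem le_of_le_add_abs_integral {l u : ℝ → ℝ} {a b c : ℝ} (ha : a ≤ 0) (hb : 0 ≤ b)
    (hl : IntegrableOn l (Icc a b)) (hl0 : ∀ t, 0 ≤ l t) (hu : ContinuousOn u (Icc a b))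
    (hu0 : ∀ t ∈ Icc a b, 0 ≤ u t)
    (h : ∀ t ∈ Icc a b, u t ≤ c + |∫ s in (0 : ℝ)..t, l s * u s|) :
    ∀ t ∈ Icc a b, u t ≤ 2 * c * Real.exp (2 * ∫ s in Icc a b, l s) := by
  -- The supremum `M` of `u / W`, with `W` the weight of `abs_integral_mul_exp_le`, satisfies
  -- `M W ≤ c + M W / 2` at a point where it is attained.
  set k : ℝ → ℝ := (Icc a b).indicator l with hk
  have hki : Integrable k := (integrable_indicator_iff measurableSet_Icc).2 hl
  have hk0 : ∀ t, 0 ≤ k t := fun t => indicator_nonneg (fun s _ => hl0 s) t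
  have hkI : ∫ s in Icc a b, l s = ∫ s, k s := (integral_indicator measurableSet_Icc).symm
  have h0 : (0 : ℝ) ∈ Icc a b := ⟨ha, hb⟩
  set W : ℝ → ℝ := fun t => Real.exp (2 * |∫ u in (0 : ℝ)..t, k u|) with hW
  have hWpos : ∀ t, 0 < W t := fun t => Real.exp_pos _
  have hWc : Continuous W := continuous_exp_abs_primitive hki 2
  obtain ⟨t₀, ht₀, hmax⟩ := isCompact_Icc.exists_isMaxOn ⟨0, h0⟩
    (hu.div hWc.continuousOn fun t _ => (hWpos t).ne')
  set M := u t₀ / W t₀ with hM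
  have hM0 : 0 ≤ M := div_nonneg (hu0 _ ht₀) (hWpos _).le
  have huM : ∀ t ∈ Icc a b, u t ≤ M * W t := fun t ht => by
    have := hmax ht
    simp only [mem_ofPred_eq] at this
    exact (div_le_iff₀ (hWpos t)).1 this
  have hint : |∫ s in (0 : ℝ)..t₀, l s * u s| ≤ M * (1 / 2 * W t₀) := by
    have h1 : |∫ s in (0 : ℝ)..t₀, l s * u s| ≤ |∫ s in (0 : ℝ)..t₀, M * (k s * W s)| := by
      rw [← Real.norm_eq_abs]
      refine intervalIntegral.norm_integral_le_abs_of_norm_le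
        (ae_restrict_of_forall_mem measurableSet_uIoc fun s hs => ?_) ?_
      · have hs' : s ∈ Icc a b := (ordConnected_Icc.uIcc_subset h0 ht₀) (uIoc_subset_uIcc hs)
        rw [hk, indicator_of_mem hs', Real.norm_of_nonneg (mul_nonneg (hl0 s) (hu0 s hs'))]
        nlinarith [huM s hs', hl0 s]
      · refine (IntervalIntegrable.mul_continuousOn hki.intervalIntegrable
          hWc.continuousOn).const_mul M
    rw [intervalIntegral.integral_const_mul, abs_mul, abs_of_nonneg hM0] at h1
    exact h1.trans (mul_le_mul_of_nonneg_left (abs_integral_mul_exp_le hki hk0 t₀) hM0)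
  have hut₀ : u t₀ = M * W t₀ := by rw [hM, div_mul_cancel₀ _ (hWpos _).ne']
  have h2 : M * W t₀ ≤ 2 * c := by have := h t₀ ht₀; linarith
  have hM2 : M ≤ 2 * c := by
    have : 1 ≤ W t₀ := Real.one_le_exp (by positivity)
    nlinarith
  intro t ht
  refine (huM t ht).trans (mul_le_mul hM2 ?_ (hWpos t).le (hM0.trans hM2))
  rw [hkI]
  exact Real.exp_le_exp.2 (by linarith [abs_integral_le_integral hki hk0 t])

/-! ### Global existence under an integrable Lipschitz coefficient -/

/-- **Global existence** for a Carathéodory equation whose right-hand side is globally Lipschitz in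
the space variable with an integrable Lipschitz coefficient `l`. The weighted unknown
`z = exp (-2 |∫₀ᵗ l|) x` is the fixed point of a contraction of the bounded continuous functions. -/
theorem exists_global_solution {X : Type*} [NormedAddCommGroup X] [NormedSpace ℝ X]
    [CompleteSpace X] {g : ℝ → X → X} {l : ℝ → ℝ} (hl : Integrable l) (hl0 : ∀ t, 0 ≤ l t)
    (hlip : ∀ᵐ s, ∀ x y, ‖g s x - g s y‖ ≤ l s * ‖x - y‖)
    (hint : ∀ x : ℝ → X, Continuous x → Integrable fun s => g s (x s)) (x₀ : X) :
    ∃ x : ℝ → X, Continuous x ∧ ∀ t, x t = x₀ + ∫ s in (0 : ℝ)..t, g s (x s) := by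
  set W : ℝ → ℝ := fun t => Real.exp (2 * |∫ u in (0 : ℝ)..t, l u|) with hW
  have hWpos : ∀ t, 0 < W t := fun t => Real.exp_pos _
  have hW1 : ∀ t, 1 ≤ W t := fun t => Real.one_le_exp (by positivity)
  have hWc : Continuous W := continuous_exp_abs_primitive hl 2
  have hWi : Continuous fun t => (W t)⁻¹ := hWc.inv₀ fun t => (hWpos t).ne'
  have hzc : ∀ z : BoundedContinuousFunction ℝ X, Continuous fun s => W s • z s :=
    fun z => hWc.smul z.continuous
  have hTc : ∀ z : BoundedContinuousFunction ℝ X,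
      Continuous fun t => (W t)⁻¹ • (x₀ + ∫ s in (0 : ℝ)..t, g s (W s • z s)) := fun z =>
    hWi.smul (continuous_const.add (intervalIntegral.continuous_primitive
      (fun a b => (hint _ (hzc z)).intervalIntegrable) 0))
  have hTb : ∀ z : BoundedContinuousFunction ℝ X, ∀ t,
      ‖(W t)⁻¹ • (x₀ + ∫ s in (0 : ℝ)..t, g s (W s • z s))‖ ≤
        ‖x₀‖ + ∫ s, ‖g s (W s • z s)‖ := fun z t => by
    rw [norm_smul, norm_inv, Real.norm_of_nonneg (hWpos t).le]
    have h1 : ‖∫ s in (0 : ℝ)..t, g s (W s • z s)‖ ≤ ∫ s, ‖g s (W s • z s)‖ := by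
      refine intervalIntegral.norm_integral_le_integral_norm_uIoc.trans ?_
      exact setIntegral_le_integral (hint _ (hzc z)).norm
        (Eventually.of_forall fun s => norm_nonneg _)
    calc (W t)⁻¹ * ‖x₀ + ∫ s in (0 : ℝ)..t, g s (W s • z s)‖
        ≤ 1 * ‖x₀ + ∫ s in (0 : ℝ)..t, g s (W s • z s)‖ := by
          gcongr
          exact inv_le_one_of_one_le₀ (hW1 t)
      _ ≤ _ := by
          rw [one_mul]
          exact (norm_add_le _ _).trans (by gcongr)
  let T : BoundedContinuousFunction ℝ X → BoundedContinuousFunction ℝ X := fun z =>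
    BoundedContinuousFunction.ofNormedAddCommGroup _ (hTc z) _ (hTb z)
  have hT : ∀ z t, T z t = (W t)⁻¹ • (x₀ + ∫ s in (0 : ℝ)..t, g s (W s • z s)) := fun z t => rfl
  have hTlip : ContractingWith (1 / 2) T := by
    refine ⟨by norm_num, LipschitzWith.of_dist_le_mul fun z w => ?_⟩
    refine (BoundedContinuousFunction.dist_le (by positivity)).2 fun t => ?_
    rw [hT, hT, dist_eq_norm, ← smul_sub, add_sub_add_left_eq_sub,
      ← intervalIntegral.integral_sub (hint _ (hzc z)).intervalIntegrable
        (hint _ (hzc w)).intervalIntegrable, norm_smul, norm_inv,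
      Real.norm_of_nonneg (hWpos t).le]
    have h1 : ‖∫ s in (0 : ℝ)..t, (g s (W s • z s) - g s (W s • w s))‖ ≤
        |∫ s in (0 : ℝ)..t, dist z w * (l s * W s)| := by
      refine intervalIntegral.norm_integral_le_abs_of_norm_le ?_ ?_
      · refine (ae_restrict_of_ae hlip).mono fun s hs => (hs _ _).trans ?_
        rw [← smul_sub, norm_smul, Real.norm_of_nonneg (hWpos s).le, ← dist_eq_norm]
        have := BoundedContinuousFunction.dist_coe_le_dist (f := z) (g := w) s
        have h2 := mul_nonneg (hl0 s) (hWpos s).le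
        nlinarith
      · exact (IntervalIntegrable.mul_continuousOn hl.intervalIntegrable
          hWc.continuousOn).const_mul _
    rw [intervalIntegral.integral_const_mul, abs_mul, abs_of_nonneg dist_nonneg] at h1
    have h3 := h1.trans (mul_le_mul_of_nonneg_left (abs_integral_mul_exp_le hl hl0 t) dist_nonneg)
    rw [inv_mul_le_iff₀ (hWpos t)]
    refine h3.trans (le_of_eq ?_)
    push_cast
    ring
  refine ⟨fun s => W s • hTlip.fixedPoint T s, hzc _, fun t => ?_⟩
  have hfix : T (hTlip.fixedPoint T) = hTlip.fixedPoint T := hTlip.fixedPoint_isFixedPt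
  have := hT (hTlip.fixedPoint T) t
  rw [hfix] at this
  simp only
  conv_lhs => rw [this]
  rw [smul_smul, mul_inv_cancel₀ (hWpos t).ne', one_smul]

/-! ### The metric projection onto a ball -/

section Radial

variable {X : Type*} [NormedAddCommGroup X] [InnerProductSpace ℝ X]

/-- The radial retraction onto the closed ball of radius `R`. In an inner product space it is the
metric projection onto the ball. -/
noncomputable def radial (R : ℝ) (x : X) : X := if ‖x‖ ≤ R then x else (R / ‖x‖) • x

theorem radial_of_norm_le {R : ℝ} {x : X} (h : ‖x‖ ≤ R) : radial R x = x := if_pos h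

theorem norm_radial_le {R : ℝ} (hR : 0 ≤ R) (x : X) : ‖radial R x‖ ≤ R := by
  unfold radial
  split_ifs with h
  · exact h
  · have hx : 0 < ‖x‖ := hR.trans_lt (not_le.1 h)
    rw [norm_smul, Real.norm_of_nonneg (by positivity), div_mul_cancel₀ _ hx.ne']

/-- The variational inequality that characterizes the metric projection. -/
theorem inner_sub_radial_le {R : ℝ} (hR : 0 ≤ R) (x : X) {z : X} (hz : ‖z‖ ≤ R) :
    inner ℝ (x - radial R x) (z - radial R x) ≤ 0 := by
  unfold radial
  split_ifs with h
  · simp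
  · have hx : 0 < ‖x‖ := hR.trans_lt (not_le.1 h)
    have e : x - (R / ‖x‖) • x = (1 - R / ‖x‖) • x := by rw [sub_smul, one_smul]
    rw [e, real_inner_smul_left, inner_sub_right, real_inner_smul_right,
      real_inner_self_eq_norm_sq]
    have h1 : 0 ≤ 1 - R / ‖x‖ := by
      rw [sub_nonneg, div_le_one hx]
      exact (not_le.1 h).le
    have h2 : R / ‖x‖ * ‖x‖ ^ 2 = R * ‖x‖ := by field_simp
    have h3 := real_inner_le_norm x z
    rw [h2]
    refine mul_nonpos_of_nonneg_of_nonpos h1 ?_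
    nlinarith

/-- The constant `1` is essential: composition with the projection must not worsen a modulus of
continuity. -/
theorem norm_radial_sub_radial_le {R : ℝ} (hR : 0 ≤ R) (x y : X) :
    ‖radial R x - radial R y‖ ≤ ‖x - y‖ := by
  have h1 := inner_sub_radial_le hR x (norm_radial_le hR y)
  have h2 := inner_sub_radial_le hR y (norm_radial_le hR x)
  set p := radial R x
  set q := radial R y
  have h3 : inner ℝ (x - p) (q - p) + inner ℝ (y - q) (p - q) =
      ‖p - q‖ ^ 2 - inner ℝ (x - y) (p - q) := by
    rw [← real_inner_self_eq_norm_sq, ← neg_sub p q, inner_neg_right]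
    simp only [inner_sub_left]
    ring
  have h4 := real_inner_le_norm (x - y) (p - q)
  by_contra! h
  have := norm_nonneg (x - y)
  nlinarith

theorem continuous_radial {R : ℝ} (hR : 0 ≤ R) : Continuous (radial R : X → X) :=
  (LipschitzWith.of_dist_le_mul (K := 1) fun x y => by
    simpa [dist_eq_norm] using norm_radial_sub_radial_le hR x y).continuous

end Radial

/-! ### Integral equations, solutions and uniqueness -/

theorem _root_.MeasureTheory.IntegrableOn.intervalIntegrable_of_mem {X : Type*}
    [NormedAddCommGroup X] {φ : ℝ → X} {a b s t : ℝ}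
    (h : IntegrableOn φ (Icc a b)) (hs : s ∈ Icc a b) (ht : t ∈ Icc a b) :
    IntervalIntegrable φ volume s t :=
  (h.mono_set (ordConnected_Icc.uIcc_subset hs ht)).intervalIntegrable

section IntegralEquations

variable {X : Type*} [NormedAddCommGroup X] [NormedSpace ℝ X]

/-- Stability of integral equations: two primitives on `[a, b] ∋ 0` are close when their initial
values are close and their densities differ by a multiple of their distance, up to a small
remainder `r`. -/
theorem norm_sub_le_of_integral_eq {x x' φ ψ : ℝ → X} {x₀ x₀' : X} {l r : ℝ → ℝ} {a b : ℝ}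
    (ha : a ≤ 0) (hb : 0 ≤ b) (hl : IntegrableOn l (Icc a b)) (hl0 : ∀ t, 0 ≤ l t)
    (hr : IntegrableOn r (Icc a b)) (hr0 : ∀ t, 0 ≤ r t)
    (hx : ContinuousOn x (Icc a b)) (hx' : ContinuousOn x' (Icc a b))
    (hφ : IntegrableOn φ (Icc a b)) (hψ : IntegrableOn ψ (Icc a b))
    (ex : ∀ t ∈ Icc a b, x t = x₀ + ∫ s in (0 : ℝ)..t, φ s)
    (ex' : ∀ t ∈ Icc a b, x' t = x₀' + ∫ s in (0 : ℝ)..t, ψ s)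
    (h : ∀ᵐ s, s ∈ Icc a b → ‖φ s - ψ s‖ ≤ l s * ‖x s - x' s‖ + r s) :
    ∀ t ∈ Icc a b, ‖x t - x' t‖ ≤
      2 * (‖x₀ - x₀'‖ + ∫ s in Icc a b, r s) * Real.exp (2 * ∫ s in Icc a b, l s) := by
  have h0 : (0 : ℝ) ∈ Icc a b := ⟨ha, hb⟩
  have hu : ContinuousOn (fun t => ‖x t - x' t‖) (Icc a b) := (hx.sub hx').norm
  refine le_of_le_add_abs_integral ha hb hl hl0 hu (fun t _ => norm_nonneg _) fun t ht => ?_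
  have hsub : uIoc 0 t ⊆ Icc a b :=
    uIoc_subset_uIcc.trans (ordConnected_Icc.uIcc_subset h0 ht)
  have hlu : IntervalIntegrable (fun s => l s * ‖x s - x' s‖) volume 0 t :=
    (hl.intervalIntegrable_of_mem h0 ht).mul_continuousOn
      (hu.mono (ordConnected_Icc.uIcc_subset h0 ht))
  have hri := hr.intervalIntegrable_of_mem h0 ht
  have e : x t - x' t = (x₀ - x₀') + ∫ s in (0 : ℝ)..t, (φ s - ψ s) := by
    rw [ex t ht, ex' t ht, intervalIntegral.integral_sub (hφ.intervalIntegrable_of_mem h0 ht)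
      (hψ.intervalIntegrable_of_mem h0 ht)]
    abel
  have h1 : ‖∫ s in (0 : ℝ)..t, (φ s - ψ s)‖ ≤
      |∫ s in (0 : ℝ)..t, (l s * ‖x s - x' s‖ + r s)| := by
    refine intervalIntegral.norm_integral_le_abs_of_norm_le ?_ (hlu.add hri)
    rw [ae_restrict_iff' measurableSet_uIoc]
    exact h.mono fun s hs hst => hs (hsub hst)
  rw [intervalIntegral.integral_add hlu hri] at h1
  have h2 : |∫ s in (0 : ℝ)..t, r s| ≤ ∫ s in Icc a b, r s := by
    rw [← Real.norm_eq_abs, intervalIntegral.norm_intervalIntegral_eq,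
      Real.norm_of_nonneg (setIntegral_nonneg measurableSet_uIoc fun u _ => hr0 u)]
    exact setIntegral_mono_set hr (Eventually.of_forall hr0) hsub.eventuallyLE
  have h3 := abs_add_le (∫ s in (0 : ℝ)..t, l s * ‖x s - x' s‖) (∫ s in (0 : ℝ)..t, r s)
  have h4 := norm_add_le (x₀ - x₀') (∫ s in (0 : ℝ)..t, (φ s - ψ s))
  rw [← e] at h4
  linarith

/-- Existence on a compact interval, from `exists_global_solution` by cutting the right-hand side
off outside the interval. -/
theorem exists_solution_Icc [CompleteSpace X] {g : ℝ → X → X} {l : ℝ → ℝ} {a b : ℝ}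
    (ha : a ≤ 0) (hb : 0 ≤ b) (hl : IntegrableOn l (Icc a b)) (hl0 : ∀ t, 0 ≤ l t)
    (hlip : ∀ᵐ s, s ∈ Icc a b → ∀ x y, ‖g s x - g s y‖ ≤ l s * ‖x - y‖)
    (hint : ∀ x : ℝ → X, Continuous x → IntegrableOn (fun s => g s (x s)) (Icc a b)) (x₀ : X) :
    ∃ x : ℝ → X, Continuous x ∧ ∀ t ∈ Icc a b, x t = x₀ + ∫ s in (0 : ℝ)..t, g s (x s) := by
  have e : ∀ (y : ℝ → X), (fun s => (Icc a b).indicator (fun s => g s (y s)) s) =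
      (Icc a b).indicator fun s => g s (y s) := fun y => rfl
  obtain ⟨x, hx, hxe⟩ := exists_global_solution
    (g := fun s z => (Icc a b).indicator (fun s => g s z) s) (l := (Icc a b).indicator l)
    ((integrable_indicator_iff measurableSet_Icc).2 hl)
    (fun t => indicator_nonneg (fun s _ => hl0 s) t)
    (hlip.mono fun s hs x y => by
      by_cases h : s ∈ Icc a b
      · simpa [indicator_of_mem h] using hs h x y
      · simp [indicator_of_notMem h])
    (fun x hx => ((integrable_indicator_iff measurableSet_Icc).2 (hint x hx)).congr
      (Eventually.of_forall fun s => by by_cases h : s ∈ Icc a b <;> simp [h])) x₀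
  refine ⟨x, hx, fun t ht => ?_⟩
  rw [hxe t]
  congr 1
  refine intervalIntegral.integral_congr fun s hs => ?_
  exact indicator_of_mem (ordConnected_Icc.uIcc_subset ⟨ha, hb⟩ ht hs) _

theorem isSolution_Ioo {g : ℝ → X → X} {x : ℝ → X} {x₀ : X} {a b : ℝ} (ha : a < 0) (hb : 0 < b)
    (hx : ContinuousOn x (Icc a b)) (hint : IntegrableOn (fun s => g s (x s)) (Icc a b))
    (he : ∀ t ∈ Icc a b, x t = x₀ + ∫ s in (0 : ℝ)..t, g s (x s)) :
    IsSolution g x₀ (Ioo a b) x where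
  isOpen := isOpen_Ioo
  ordConnected := ordConnected_Ioo
  zero_mem := ⟨ha, hb⟩
  continuousOn := hx.mono Ioo_subset_Icc_self
  integrable _ ht := hint.intervalIntegrable_of_mem ⟨ha.le, hb.le⟩ (Ioo_subset_Icc_self ht)
  eq _ ht := he _ (Ioo_subset_Icc_self ht)

/-- Uniqueness for the Cauchy problem: any two solutions agree on the common part of their
intervals. -/
def HasUniqueSolutions (g : ℝ → X → X) (x₀ : X) : Prop :=
  ∀ ⦃J J' : Set ℝ⦄ ⦃x x' : ℝ → X⦄, IsSolution g x₀ J x → IsSolution g x₀ J' x' → EqOn x x' (J ∩ J')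

theorem IsSolution.subset_maxInterval {g : ℝ → X → X} {x : ℝ → X} {x₀ : X} {J : Set ℝ}
    (h : IsSolution g x₀ J x) : J ⊆ maxInterval g x₀ := fun _ ht => ⟨J, x, h, ht⟩

theorem IsSolution.solution_eq {g : ℝ → X → X} {x : ℝ → X} {x₀ : X} {J : Set ℝ}
    (hU : HasUniqueSolutions g x₀) (h : IsSolution g x₀ J x) {t : ℝ} (ht : t ∈ J) :
    solution g x₀ t = x t := by
  have hex : ∃ (x : ℝ → X) (J : Set ℝ), IsSolution g x₀ J x ∧ t ∈ J := ⟨x, J, h, ht⟩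
  unfold solution
  rw [dif_pos hex]
  obtain ⟨J', h', ht'⟩ := hex.choose_spec
  exact hU h' h ⟨ht', ht⟩

/-- Under uniqueness, the local solutions glue to a solution on the whole maximal interval. -/
theorem isSolution_solution {g : ℝ → X → X} {x₀ : X} (hU : HasUniqueSolutions g x₀)
    (hne : (maxInterval g x₀).Nonempty) :
    IsSolution g x₀ (maxInterval g x₀) (solution g x₀) where
  isOpen := isOpen_iff_mem_nhds.2 fun _ ⟨_, _, h, ht⟩ =>
    mem_of_superset (h.isOpen.mem_nhds ht) h.subset_maxInterval
  ordConnected := by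
    refine ⟨fun s ⟨J, x, h, hs⟩ t ⟨J', x', h', ht⟩ u hu => ?_⟩
    rcases le_total 0 u with h0 | h0
    · exact h'.subset_maxInterval (h'.ordConnected.out h'.zero_mem ht ⟨h0, hu.2⟩)
    · exact h.subset_maxInterval (h.ordConnected.out hs h.zero_mem ⟨hu.1, h0⟩)
  zero_mem := by
    obtain ⟨t, J, x, h, -⟩ := hne
    exact h.subset_maxInterval h.zero_mem
  continuousOn := by
    rintro t ⟨J, x, h, ht⟩
    have h1 : ContinuousAt x t := h.continuousOn.continuousAt (h.isOpen.mem_nhds ht)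
    refine (h1.congr ?_).continuousWithinAt
    filter_upwards [h.isOpen.mem_nhds ht] with s hs using (h.solution_eq hU hs).symm
  integrable := by
    rintro t ⟨J, x, h, ht⟩
    refine (h.integrable t ht).congr fun s hs => ?_
    rw [h.solution_eq hU (h.ordConnected.uIcc_subset h.zero_mem ht (uIoc_subset_uIcc hs))]
  eq := by
    rintro t ⟨J, x, h, ht⟩
    rw [h.solution_eq hU ht, h.eq t ht]
    congr 1
    refine intervalIntegral.integral_congr fun s hs => ?_
    rw [h.solution_eq hU (h.ordConnected.uIcc_subset h.zero_mem ht hs)]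

end IntegralEquations

/-! ### Carathéodory functions along curves -/

section Superposition

variable {N : ℕ} {Y : Type*} [NormedAddCommGroup Y] [MeasurableSpace Y] {p : ℝ}

theorem IsLpLoc.integrableOn {m : ℝ → ℝ} (hp : 1 ≤ p) (h : IsLpLoc p m) (a b : ℝ) :
    IntegrableOn m (Icc a b) :=
  (h a b).integrable (by simpa using ENNReal.ofReal_le_ofReal hp)

theorem IsC.exists_bound {f : ℝ → V N → Y} (hp : 1 ≤ p) (hf : IsC p f) (R : ℝ) :
    ∃ m : ℝ → ℝ, (∀ t, 0 ≤ m t) ∧ (∀ a b, IntegrableOn m (Icc a b)) ∧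
      ∀ᵐ t : ℝ, ∀ x, ‖x‖ ≤ R → ‖f t x‖ ≤ m t := by
  obtain ⟨m, hm, h⟩ := hf.mBound (Metric.closedBall 0 R) (isCompact_closedBall 0 R)
  refine ⟨fun t => |m t|, fun t => abs_nonneg _, fun a b => (hm.integrableOn hp a b).abs, ?_⟩
  exact h.mono fun t ht x hx => (ht x (mem_closedBall_zero_iff.2 hx)).trans (le_abs_self _)

theorem exists_lipschitz_bound {f : ℝ → V N → Y} (hp : 1 ≤ p) (hf : f ∈ LC p N Y) (R : ℝ) :
    ∃ l : ℝ → ℝ, (∀ t, 0 ≤ l t) ∧ (∀ a b, IntegrableOn l (Icc a b)) ∧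
      ∀ᵐ t : ℝ, ∀ x y, ‖x‖ ≤ R → ‖y‖ ≤ R → ‖f t x - f t y‖ ≤ l t * ‖x - y‖ := by
  obtain ⟨l, hl, h⟩ := hf.2 (Metric.closedBall 0 R) (isCompact_closedBall 0 R)
  refine ⟨fun t => |l t|, fun t => abs_nonneg _, fun a b => (hl.integrableOn hp a b).abs, ?_⟩
  exact h.mono fun t ht x y hx hy =>
    (ht x (mem_closedBall_zero_iff.2 hx) y (mem_closedBall_zero_iff.2 hy)).trans
      (mul_le_mul_of_nonneg_right (le_abs_self _) (norm_nonneg _))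

theorem _root_.ContinuousOn.exists_norm_le_Icc {X : Type*} [NormedAddCommGroup X] {x : ℝ → X}
    {a b : ℝ} (hx : ContinuousOn x (Icc a b)) : ∃ R, ∀ t ∈ Icc a b, ‖x t‖ ≤ R :=
  isCompact_Icc.exists_bound_of_continuousOn hx

/-- A Carathéodory function composed with a continuous curve is integrable. -/
theorem IsC.integrableOn_comp [OpensMeasurableSpace Y] [SecondCountableTopology Y]
    {f : ℝ → V N → Y} (hp : 1 ≤ p) (hf : IsC p f) {x : ℝ → V N} {a b : ℝ}
    (hx : ContinuousOn x (Icc a b)) : IntegrableOn (fun s => f s (x s)) (Icc a b) := by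
  obtain ⟨R, hR⟩ := hx.exists_norm_le_Icc
  obtain ⟨m, -, hm, h⟩ := hf.exists_bound hp R
  refine (hm a b).mono' ?_ ?_
  · exact (hf.measurable.comp_aemeasurable
      (aemeasurable_id.prodMk (hx.aemeasurable measurableSet_Icc))).aestronglyMeasurable
  · rw [ae_restrict_iff' measurableSet_Icc]
    exact h.mono fun s hs hsI => hs _ (hR s hsI)

theorem hasUniqueSolutions_of_mem_LC {f : ℝ → V N → V N} (hp : 1 ≤ p) (hf : f ∈ LC p N (V N))
    (x₀ : V N) : HasUniqueSolutions f x₀ := by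
  intro J J' x x' h h' t ht
  have hI : Icc (min 0 t) (max 0 t) ⊆ J ∩ J' :=
    (h.ordConnected.inter h'.ordConnected).uIcc_subset ⟨h.zero_mem, h'.zero_mem⟩ ht
  have hx := h.continuousOn.mono (hI.trans inter_subset_left)
  have hx' := h'.continuousOn.mono (hI.trans inter_subset_right)
  obtain ⟨R, hR⟩ := hx.exists_norm_le_Icc
  obtain ⟨R', hR'⟩ := hx'.exists_norm_le_Icc
  obtain ⟨l, hl0, hl, hlip⟩ := exists_lipschitz_bound hp hf (max R R')
  have key := norm_sub_le_of_integral_eq (min_le_left 0 t) (le_max_left 0 t) (hl _ _) hl0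
    (r := fun _ => 0) integrableOn_zero (fun _ => le_rfl) hx hx'
    (hf.1.integrableOn_comp hp hx) (hf.1.integrableOn_comp hp hx')
    (fun s hs => h.eq s (hI hs).1) (fun s hs => h'.eq s (hI hs).2)
    (hlip.mono fun s hs hsI => by
      simpa using hs _ _ ((hR s hsI).trans (le_max_left _ _))
        ((hR' s hsI).trans (le_max_right _ _))) t ⟨min_le_right _ _, le_max_right _ _⟩
  simpa [sub_eq_zero] using key

end Superposition

/-! ### Convergence in the topology `T_Θ` -/

section Convergence

variable {N : ℕ} {Y : Type*} [NormedAddCommGroup Y] {p : ℝ}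

theorem thetaSeminorm_zero (hp : 1 ≤ p) (Θ : Moduli) (j : ℕ) (q₁ q₂ : ℚ) :
    thetaSeminorm p Θ j q₁ q₂ (0 : ℝ → V N → Y) = 0 := by
  have h : 0 < p := by linarith
  simp [thetaSeminorm, ENNReal.zero_rpow_of_pos, h]

theorem tendsto_thetaSeminorm_sub (hp : 1 ≤ p) {Θ : Moduli} {S : Set (ℝ → V N → Y)}
    {fs : ℕ → S} {f : S} (h : Tendsto fs atTop (@nhds _ (TTheta p Θ S) f)) (j : ℕ) {q₁ q₂ : ℚ}
    (hq : q₁ ≤ q₂) :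
    Tendsto (fun n => thetaSeminorm p Θ j q₁ q₂ ((fs n).1 - f.1)) atTop (𝓝 0) := by
  rw [ENNReal.tendsto_nhds_zero]
  intro ε hε
  let := TTheta p Θ S
  have ho : IsOpen {g : S | thetaSeminorm p Θ j q₁ q₂ (g.1 - f.1) < ε} :=
    TopologicalSpace.isOpen_generateFrom_of_mem ⟨f, j, q₁, q₂, ε, hq, hε, rfl⟩
  refine (h.eventually (ho.mem_nhds ?_)).mono fun n hn => le_of_lt hn
  simpa [thetaSeminorm_zero hp] using hε

/-- On a bounded interval convergence in `L^p` implies convergence in `L^1`. -/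
theorem tendsto_integral_norm_of_tendsto_lintegral_rpow (hp : 1 ≤ p) {a b : ℝ} {g : ℕ → ℝ → Y}
    (hg : ∀ n, IntegrableOn (g n) (Icc a b))
    (h : Tendsto (fun n => (∫⁻ t in Icc a b, ‖g n t‖ₑ ^ p) ^ (1 / p)) atTop (𝓝 0)) :
    Tendsto (fun n => ∫ t in Icc a b, ‖g n t‖) atTop (𝓝 0) := by
  have hp0 : 0 < p := by linarith
  have e : ∀ n, eLpNorm (g n) (ENNReal.ofReal p) (volume.restrict (Icc a b)) =
      (∫⁻ t in Icc a b, ‖g n t‖ₑ ^ p) ^ (1 / p) := fun n => by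
    rw [eLpNorm_eq_lintegral_rpow_enorm_toReal (by simpa using hp0) ENNReal.ofReal_ne_top,
      ENNReal.toReal_ofReal hp0.le]
  have h1 : ∀ n, ∫⁻ t in Icc a b, ‖g n t‖ₑ ≤ (∫⁻ t in Icc a b, ‖g n t‖ₑ ^ p) ^ (1 / p) *
      volume.restrict (Icc a b) univ ^ (1 / (1 : ℝ≥0∞).toReal - 1 / (ENNReal.ofReal p).toReal) :=
    fun n => by
      rw [← e, ← eLpNorm_one_eq_lintegral_enorm]
      exact eLpNorm_le_eLpNorm_mul_rpow_measure_univ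
        (by simpa using ENNReal.ofReal_le_ofReal hp) (hg n).aestronglyMeasurable
  have hfin : volume.restrict (Icc a b) univ ^
      (1 / (1 : ℝ≥0∞).toReal - 1 / (ENNReal.ofReal p).toReal) ≠ ⊤ := by
    refine ENNReal.rpow_ne_top_of_nonneg ?_ (by simp)
    rw [ENNReal.toReal_ofReal hp0.le, ENNReal.toReal_one, sub_nonneg]
    simpa using inv_le_one_of_one_le₀ hp
  have h2 : Tendsto (fun n => ∫⁻ t in Icc a b, ‖g n t‖ₑ) atTop (𝓝 0) := by
    have := ENNReal.Tendsto.mul_const h (Or.inr hfin)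
    rw [zero_mul] at this
    exact tendsto_of_tendsto_of_tendsto_of_le_of_le tendsto_const_nhds this
      (fun _ => zero_le) h1
  have h3 := (ENNReal.tendsto_toReal ENNReal.zero_ne_top).comp h2
  simpa only [Function.comp_def, ENNReal.toReal_zero,
    ← integral_norm_eq_lintegral_enorm (hg _).aestronglyMeasurable] using h3

variable [MeasurableSpace Y] [OpensMeasurableSpace Y] [SecondCountableTopology Y]

/-- Convergence in the topology `T_Θ` gives `L^1` convergence along curves of `K_j^I` that may vary
with the index. -/
theorem tendsto_integral_norm_sub_of_tendsto_thetaSeminorm (hp : 1 ≤ p) {Θ : Moduli} {j : ℕ}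
    {q₁ q₂ : ℚ} {fs : ℕ → ℝ → V N → Y} {f : ℝ → V N → Y} (hfs : ∀ n, IsC p (fs n)) (hf : IsC p f)
    (h : Tendsto (fun n => thetaSeminorm p Θ j q₁ q₂ (fs n - f)) atTop (𝓝 0))
    {xs : ℕ → ℝ → V N} (hxs : ∀ n, xs n ∈ KSet Θ j q₁ q₂) :
    Tendsto (fun n => ∫ t in Icc (q₁ : ℝ) q₂, ‖fs n t (xs n t) - f t (xs n t)‖) atTop (𝓝 0) := by
  refine tendsto_integral_norm_of_tendsto_lintegral_rpow hp
    (fun n => ((hfs n).integrableOn_comp hp (hxs n).1).sub (hf.integrableOn_comp hp (hxs n).1)) ?_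
  exact tendsto_of_tendsto_of_tendsto_of_le_of_le tendsto_const_nhds h (fun _ => zero_le)
    fun n => le_iSup₂_of_le (xs n) (hxs n) le_rfl

theorem tendsto_integral_norm_sub_of_mem_ThetaC (hp : 1 ≤ p) {Θ : Moduli} {j : ℕ} {q₁ q₂ : ℚ}
    (hq : q₁ ≤ q₂) {f : ℝ → V N → Y} (hf : f ∈ ThetaC p Θ N Y) {xs : ℕ → ℝ → V N} {x : ℝ → V N}
    (hxs : ∀ n, xs n ∈ KSet Θ j q₁ q₂) (hx : x ∈ KSet Θ j q₁ q₂)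
    (h : TendstoUniformlyOn xs x atTop (Icc (q₁ : ℝ) q₂)) :
    Tendsto (fun n => ∫ t in Icc (q₁ : ℝ) q₂, ‖f t (xs n t) - f t (x t)‖) atTop (𝓝 0) := by
  have hp0 : 0 < p := by linarith
  refine tendsto_integral_norm_of_tendsto_lintegral_rpow hp
    (fun n => (hf.1.integrableOn_comp hp (hxs n).1).sub (hf.1.integrableOn_comp hp hx.1)) ?_
  have := (ENNReal.continuous_rpow_const (y := 1 / p)).continuousAt.tendsto.comp
    (hf.2 j q₁ q₂ hq xs x hxs hx h)
  rwa [ENNReal.zero_rpow_of_pos (by positivity)] at this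

end Convergence

/-! ### Curves with the moduli of continuity of `E` -/

section Curves

variable {N : ℕ}

theorem mem_KSet_of_tendstoUniformlyOn {Θ : Moduli} {j : ℕ} {q₁ q₂ : ℚ} {xs : ℕ → ℝ → V N}
    {x : ℝ → V N} (hxs : ∀ n, xs n ∈ KSet Θ j q₁ q₂)
    (h : TendstoUniformlyOn xs x atTop (Icc (q₁ : ℝ) q₂)) : x ∈ KSet Θ j q₁ q₂ := by
  refine ⟨h.continuousOn (Eventually.of_forall fun n => (hxs n).1).frequently, fun t ht => ?_,
    fun s hs t ht => ?_⟩
  · exact Metric.isClosed_closedBall.mem_of_tendsto (h.tendsto_at ht)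
      (Eventually.of_forall fun n => (hxs n).2.1 t ht)
  · exact le_of_tendsto ((h.tendsto_at hs).nndist (h.tendsto_at ht))
      (Eventually.of_forall fun n => (hxs n).2.2 s hs t ht)

/-- A solution of the truncated equation `x' = f(t, P x)`, `f ∈ E`, projected on the ball of radius
`j`, has the moduli of continuity built from the `m`-bounds of `E`. -/
theorem radial_comp_mem_KSet {E : Set (ℝ → V N → V N)} (hE : HasEquicontMBounds E)
    {f : ℝ → V N → V N} (hf : f ∈ E) {j : ℕ} {q₁ q₂ : ℚ} (h1 : (q₁ : ℝ) ≤ 0) (h2 : 0 ≤ (q₂ : ℝ))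
    {x : ℝ → V N} {x₀ : V N} (hx : ContinuousOn x (Icc (q₁ : ℝ) q₂))
    (hint : IntegrableOn (fun s => f s (radial j (x s))) (Icc (q₁ : ℝ) q₂))
    (he : ∀ t ∈ Icc (q₁ : ℝ) q₂, x t = x₀ + ∫ s in (0 : ℝ)..t, f s (radial j (x s))) :
    (fun t => radial j (x t)) ∈ KSet (moduliOf E hE) j q₁ q₂ := by
  have hj : (0 : ℝ) ≤ j := Nat.cast_nonneg j
  refine ⟨(continuous_radial hj).comp_continuousOn hx, fun t _ =>
    mem_closedBall_zero_iff.2 (norm_radial_le hj _), ?_⟩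
  have key : ∀ s ∈ Icc (q₁ : ℝ) q₂, ∀ t ∈ Icc (q₁ : ℝ) q₂, s ≤ t →
      nndist (radial j (x s)) (radial j (x t)) ≤ (moduliOf E hE).θ j q₁ q₂ (nndist s t) := by
    intro s hs t ht hst
    have h0 : (0 : ℝ) ∈ Icc (q₁ : ℝ) q₂ := ⟨h1, h2⟩
    have e : x t - x s = ∫ u in s..t, f u (radial j (x u)) := by
      rw [he t ht, he s hs, add_sub_add_left_eq_sub, intervalIntegral.integral_interval_sub_left
        (hint.intervalIntegrable_of_mem h0 ht) (hint.intervalIntegrable_of_mem h0 hs)]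
    have ht' : t = s + (nndist s t : ℝ≥0) := by
      rw [coe_nndist, dist_comm, Real.dist_eq, abs_of_nonneg (sub_nonneg.2 hst)]
      ring
    have hle : (nndist (radial j (x s)) (radial j (x t)) : ℝ≥0∞) ≤
        supModulus E j q₁ q₂ (nndist s t) := calc
      (nndist (radial j (x s)) (radial j (x t)) : ℝ≥0∞) ≤ ‖x t - x s‖ₑ := by
        rw [enorm_eq_nnnorm, ENNReal.coe_le_coe, ← NNReal.coe_le_coe, coe_nndist, coe_nnnorm,
          dist_comm, dist_eq_norm]
        exact norm_radial_sub_radial_le hj _ _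
      _ ≤ ∫⁻ u in Ioc s t, ‖f u (radial j (x u))‖ₑ := by
        rw [e, intervalIntegral.integral_of_le hst]
        exact enorm_integral_le_lintegral_enorm _
      _ ≤ ∫⁻ u in Icc s t, ‖f u (radial j (x u))‖ₑ := lintegral_mono_set Ioc_subset_Icc_self
      _ ≤ ∫⁻ u in Icc s t, optMBound f j u := lintegral_mono fun u =>
        le_iSup₂_of_le (f := fun (z : V N) (_ : z ∈ Metric.closedBall (0 : V N) j) => ‖f u z‖ₑ)
          (radial j (x u)) (mem_closedBall_zero_iff.2 (norm_radial_le hj _)) le_rfl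
      _ ≤ supModulus E j q₁ q₂ (nndist s t) := by
        conv_lhs => rw [ht']
        exact le_iSup₂_of_le s hs (le_iSup₂_of_le f hf (by rw [← ht']))
    exact ENNReal.coe_le_coe.1 (hle.trans
      (ENNReal.coe_toNNReal (supModulus_ne_top hE j q₁ q₂ _)).ge)
  intro s hs t ht
  rcases le_total s t with hst | hst
  · exact key s hs t ht hst
  · rw [nndist_comm, nndist_comm s t]
    exact key t ht s hs hst

end Curves

/-! ### Convergence of the solutions of the nonlinear equation -/

theorem tendstoUniformlyOn_of_norm_sub_le {X : Type*} [NormedAddCommGroup X] {xs : ℕ → ℝ → X}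
    {x : ℝ → X} {s : Set ℝ} {c : ℕ → ℝ} (h : ∀ n, ∀ t ∈ s, ‖xs n t - x t‖ ≤ c n)
    (hc : Tendsto c atTop (𝓝 0)) : TendstoUniformlyOn xs x atTop s := by
  rw [Metric.tendstoUniformlyOn_iff]
  intro ε hε
  filter_upwards [hc.eventually_lt_const hε] with n hn t ht
  rw [dist_comm, dist_eq_norm]
  exact (h n t ht).trans_lt hn

/-- The moduli `θ_j^I` are indexed by intervals with rational end points, so a compact interval of
existence is first enlarged to such an interval around `0`. -/
theorem exists_rat_Icc_subset {M : Set ℝ} (hM : IsOpen M) (hM' : M.OrdConnected)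
    (h0 : (0 : ℝ) ∈ M) {T₁ T₂ : ℝ} (hT : T₁ ≤ T₂) (h : Icc T₁ T₂ ⊆ M) :
    ∃ q₁ q₂ : ℚ, (q₁ : ℝ) < 0 ∧ (0 : ℝ) < q₂ ∧ Icc (q₁ : ℝ) q₂ ⊆ M ∧
      Icc T₁ T₂ ⊆ Ioo (q₁ : ℝ) q₂ := by
  have ha : min T₁ 0 ∈ M := by
    rcases min_choice T₁ 0 with e | e <;> rw [e]
    exacts [h (left_mem_Icc.2 hT), h0]
  have hb : max T₂ 0 ∈ M := by
    rcases max_choice T₂ 0 with e | e <;> rw [e]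
    exacts [h (right_mem_Icc.2 hT), h0]
  obtain ⟨ε, hε, hεM⟩ := Metric.isOpen_iff.1 hM _ ha
  obtain ⟨η, hη, hηM⟩ := Metric.isOpen_iff.1 hM _ hb
  obtain ⟨q₁, h1, h1'⟩ := exists_rat_btwn (sub_lt_self (min T₁ 0) hε)
  obtain ⟨q₂, h2, h2'⟩ := exists_rat_btwn (lt_add_of_pos_right (max T₂ 0) hη)
  have hq₁ : (q₁ : ℝ) ∈ M := hεM (by
    rw [Metric.mem_ball, Real.dist_eq, abs_lt]; constructor <;> linarith)
  have hq₂ : (q₂ : ℝ) ∈ M := hηM (by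
    rw [Metric.mem_ball, Real.dist_eq, abs_lt]; constructor <;> linarith)
  exact ⟨q₁, q₂, h1'.trans_le (min_le_right _ _), (le_max_right _ _).trans_lt h2,
    hM'.out hq₁ hq₂, fun t ht => ⟨h1'.trans_le ((min_le_left _ _).trans ht.1),
      (ht.2.trans (le_max_left _ _)).trans_lt h2⟩⟩

/-- The solutions `zₙ` of the truncated equations, projected on a ball of radius `j` around the
limit solution, are curves of `K_j^I` and converge uniformly on `I`; for large `n` they solve the
original equations. -/
theorem exists_projected_solutions {N : ℕ} {p : ℝ} (hp : 1 ≤ p) {E : Set (ℝ → V N → V N)}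
    (hE : HasEquicontMBounds E) {fs : ℕ → LC p N (V N)} (hfs : ∀ n, (fs n).1 ∈ E)
    {f : LC p N (V N)}
    (hf : Tendsto fs atTop (@nhds _ (TTheta p (moduliOf E hE) (LC p N (V N))) f))
    {x₀s : ℕ → V N} {x₀ : V N} (hx₀ : Tendsto x₀s atTop (𝓝 x₀)) {q₁ q₂ : ℚ}
    (hq₁ : (q₁ : ℝ) < 0) (hq₂ : (0 : ℝ) < q₂) (hq : Icc (q₁ : ℝ) q₂ ⊆ maxInterval f.1 x₀) :
    ∃ (j : ℕ) (zs : ℕ → ℝ → V N), (∀ n, zs n ∈ KSet (moduliOf E hE) j q₁ q₂) ∧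
      TendstoUniformlyOn zs (solution f.1 x₀) atTop (Icc (q₁ : ℝ) q₂) ∧
      ∀ᶠ n in atTop, IsSolution (fs n).1 (x₀s n) (Ioo (q₁ : ℝ) q₂) (zs n) := by
  have hq₁₂ : q₁ ≤ q₂ := by exact_mod_cast (hq₁.trans hq₂).le
  have hsol := isSolution_solution (hasUniqueSolutions_of_mem_LC hp f.2 x₀)
    ⟨0, hq ⟨hq₁.le, hq₂.le⟩⟩
  set x := solution f.1 x₀
  have hxc : ContinuousOn x (Icc (q₁ : ℝ) q₂) := hsol.continuousOn.mono hq
  obtain ⟨R, hR⟩ := hxc.exists_norm_le_Icc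
  -- The margin `1` keeps the truncated solutions inside the ball once they are `1`-close to `x`.
  obtain ⟨j, hj⟩ := exists_nat_ge (R + 1)
  have hj0 : (0 : ℝ) ≤ j := Nat.cast_nonneg j
  have hP : Continuous (radial j : V N → V N) := continuous_radial hj0
  have hex : ∀ n, ∃ w : ℝ → V N, Continuous w ∧ ∀ t ∈ Icc (q₁ : ℝ) q₂,
      w t = x₀s n + ∫ s in (0 : ℝ)..t, (fs n).1 s (radial j (w s)) := fun n => by
    obtain ⟨l, hl0, hl, hlip⟩ := exists_lipschitz_bound hp (fs n).2 j
    refine exists_solution_Icc (g := fun s z => (fs n).1 s (radial j z)) hq₁.le hq₂.le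
      (hl _ _) hl0 ?_
      (fun w hw => (fs n).2.1.integrableOn_comp hp (hP.comp hw).continuousOn) _
    refine hlip.mono fun s hs _ u v => ?_
    exact (hs _ _ (norm_radial_le hj0 _) (norm_radial_le hj0 _)).trans
      (mul_le_mul_of_nonneg_left (norm_radial_sub_radial_le hj0 _ _) (hl0 s))
  choose w hwc hw using hex
  have hfi : ∀ n, IntegrableOn (fun s => (fs n).1 s (radial j (w n s))) (Icc (q₁ : ℝ) q₂) :=
    fun n => (fs n).2.1.integrableOn_comp hp (hP.comp (hwc n)).continuousOn
  have hfi' : ∀ n, IntegrableOn (fun s => f.1 s (radial j (w n s))) (Icc (q₁ : ℝ) q₂) :=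
    fun n => f.2.1.integrableOn_comp hp (hP.comp (hwc n)).continuousOn
  have hK : ∀ n, (fun t => radial j (w n t)) ∈ KSet (moduliOf E hE) j q₁ q₂ := fun n =>
    radial_comp_mem_KSet hE (hfs n) hq₁.le hq₂.le (hwc n).continuousOn (hfi n) (hw n)
  have hr := tendsto_integral_norm_sub_of_tendsto_thetaSeminorm hp (fun n => (fs n).2.1) f.2.1
    (tendsto_thetaSeminorm_sub hp hf j hq₁₂) hK
  have hxP : ∀ t ∈ Icc (q₁ : ℝ) q₂, radial j (x t) = x t := fun t ht =>
    radial_of_norm_le (by linarith [hR t ht])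
  obtain ⟨l, hl0, hl, hlip⟩ := exists_lipschitz_bound hp f.2 j
  -- The kernel is the Lipschitz coefficient `l` of the limit `f`: the coefficients of the `fₙ` need
  -- not be bounded. The remainder is `fₙ - f` along the projected curves.
  have hbound : ∀ n, ∀ t ∈ Icc (q₁ : ℝ) q₂, ‖w n t - x t‖ ≤ 2 * (‖x₀s n - x₀‖ +
      ∫ s in Icc (q₁ : ℝ) q₂, ‖(fs n).1 s (radial j (w n s)) - f.1 s (radial j (w n s))‖) *
        Real.exp (2 * ∫ s in Icc (q₁ : ℝ) q₂, l s) := fun n => by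
    refine norm_sub_le_of_integral_eq hq₁.le hq₂.le (hl _ _) hl0 ((hfi n).sub (hfi' n)).norm
      (fun _ => norm_nonneg _) (hwc n).continuousOn hxc (hfi n)
      (f.2.1.integrableOn_comp hp hxc) (hw n) (fun t ht => hsol.eq t (hq ht)) ?_
    refine hlip.mono fun s hs hsI => ?_
    have h1 := hs (radial j (w n s)) (x s) (norm_radial_le hj0 _) (by linarith [hR s hsI])
    have h2 : ‖radial j (w n s) - x s‖ ≤ ‖w n s - x s‖ := by
      have := norm_radial_sub_radial_le hj0 (w n s) (x s)
      rwa [hxP s hsI] at this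
    have h3 := norm_sub_le_norm_sub_add_norm_sub ((fs n).1 s (radial j (w n s)))
      (f.1 s (radial j (w n s))) (f.1 s (x s))
    have h4 := mul_le_mul_of_nonneg_left h2 (hl0 s)
    linarith
  have hlim : Tendsto (fun n => 2 * (‖x₀s n - x₀‖ + ∫ s in Icc (q₁ : ℝ) q₂,
      ‖(fs n).1 s (radial j (w n s)) - f.1 s (radial j (w n s))‖) *
        Real.exp (2 * ∫ s in Icc (q₁ : ℝ) q₂, l s)) atTop (𝓝 0) := by
    simpa using (((tendsto_iff_norm_sub_tendsto_zero.1 hx₀).add hr).const_mul 2).mul_const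
      (Real.exp (2 * ∫ s in Icc (q₁ : ℝ) q₂, l s))
  refine ⟨j, fun n t => radial j (w n t), hK, ?_, ?_⟩
  · refine tendstoUniformlyOn_of_norm_sub_le (fun n t ht => ?_) hlim
    have := norm_radial_sub_radial_le hj0 (w n t) (x t)
    rw [hxP t ht] at this
    exact this.trans (hbound n t ht)
  · filter_upwards [hlim.eventually_lt_const one_pos] with n hn
    have hin : ∀ t ∈ Icc (q₁ : ℝ) q₂, radial j (w n t) = w n t := fun t ht => by
      refine radial_of_norm_le ?_
      have h1 := (hbound n t ht).trans hn.le
      have h2 := norm_le_norm_add_norm_sub (x t) (w n t)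
      rw [norm_sub_rev] at h2
      linarith [hR t ht]
    exact isSolution_Ioo hq₁ hq₂ (hP.comp (hwc n)).continuousOn (hfi n)
      fun t ht => (hin t ht).trans (hw n t ht)

/-! ### Linear equations with integrable coefficients -/

section Linear

variable {X : Type*} [NormedAddCommGroup X] [NormedSpace ℝ X] {a b : ℝ}

theorem integrableOn_clm_apply {A : ℝ → X →L[ℝ] X} {y : ℝ → X} (hA : IntegrableOn A (Icc a b))
    (hy : ContinuousOn y (Icc a b)) : IntegrableOn (fun s => A s (y s)) (Icc a b) := by
  obtain ⟨R, hR⟩ := hy.exists_norm_le_Icc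
  refine (hA.norm.mul_const R).mono' ?_ ?_
  · exact (ContinuousLinearMap.id ℝ (X →L[ℝ] X)).aestronglyMeasurable_comp₂
      hA.aestronglyMeasurable (hy.aestronglyMeasurable_of_isCompact isCompact_Icc measurableSet_Icc)
  · exact ae_restrict_of_forall_mem measurableSet_Icc fun s hs =>
      (A s).le_opNorm_of_le (hR s hs)

theorem exists_linear_solution [CompleteSpace X] {A : ℝ → X →L[ℝ] X} {c : ℝ → X} (ha : a ≤ 0)
    (hb : 0 ≤ b) (hA : IntegrableOn A (Icc a b)) (hc : IntegrableOn c (Icc a b)) (y₀ : X) :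
    ∃ y : ℝ → X, Continuous y ∧
      ∀ t ∈ Icc a b, y t = y₀ + ∫ s in (0 : ℝ)..t, (A s (y s) + c s) :=
  exists_solution_Icc (g := fun s z => A s z + c s) ha hb hA.norm (fun _ => norm_nonneg _)
    (Eventually.of_forall fun s _ u v => by
      rw [add_sub_add_right_eq_sub, ← map_sub]
      exact (A s).le_opNorm _)
    (fun _ hy => (integrableOn_clm_apply hA hy.continuousOn).add hc) y₀

/-- Continuous dependence for linear equations whose coefficients converge in `L^1`. -/
theorem tendstoUniformlyOn_linear {As : ℕ → ℝ → X →L[ℝ] X} {A : ℝ → X →L[ℝ] X}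
    {cs : ℕ → ℝ → X} {c : ℝ → X} (ha : a ≤ 0) (hb : 0 ≤ b)
    (hAs : ∀ n, IntegrableOn (As n) (Icc a b)) (hA : IntegrableOn A (Icc a b))
    (hcs : ∀ n, IntegrableOn (cs n) (Icc a b)) (hc : IntegrableOn c (Icc a b))
    (hAl : Tendsto (fun n => ∫ s in Icc a b, ‖As n s - A s‖) atTop (𝓝 0))
    (hcl : Tendsto (fun n => ∫ s in Icc a b, ‖cs n s - c s‖) atTop (𝓝 0))
    {y₀s : ℕ → X} {y₀ : X} (hy₀ : Tendsto y₀s atTop (𝓝 y₀)) {ys : ℕ → ℝ → X} {y : ℝ → X}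
    (hysc : ∀ n, ContinuousOn (ys n) (Icc a b)) (hyc : ContinuousOn y (Icc a b))
    (hys : ∀ n, ∀ t ∈ Icc a b, ys n t = y₀s n + ∫ s in (0 : ℝ)..t, (As n s (ys n s) + cs n s))
    (hy : ∀ t ∈ Icc a b, y t = y₀ + ∫ s in (0 : ℝ)..t, (A s (y s) + c s)) :
    TendstoUniformlyOn ys y atTop (Icc a b) := by
  obtain ⟨R, hR⟩ := hyc.exists_norm_le_Icc
  have hR0 : 0 ≤ R := (norm_nonneg _).trans (hR 0 ⟨ha, hb⟩)
  have hAi : ∀ n, IntegrableOn (fun s => ‖As n s - A s‖) (Icc a b) := fun n =>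
    ((hAs n).sub hA).norm
  have hci : ∀ n, IntegrableOn (fun s => ‖cs n s - c s‖) (Icc a b) := fun n =>
    ((hcs n).sub hc).norm
  have hbound : ∀ n, ∀ t ∈ Icc a b, ‖ys n t - y t‖ ≤
      2 * (‖y₀s n - y₀‖ + (R * (∫ s in Icc a b, ‖As n s - A s‖) +
        ∫ s in Icc a b, ‖cs n s - c s‖)) *
      Real.exp (2 * ((∫ s in Icc a b, ‖A s‖) + ∫ s in Icc a b, ‖As n s - A s‖)) := by
    intro n t ht
    have h1 := norm_sub_le_of_integral_eq ha hb (hAs n).norm (fun _ => norm_nonneg _)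
      (((hAi n).const_mul R).add (hci n))
      (fun s => add_nonneg (mul_nonneg hR0 (norm_nonneg _)) (norm_nonneg _)) (hysc n) hyc
      ((integrableOn_clm_apply (hAs n) (hysc n)).add (hcs n))
      ((integrableOn_clm_apply hA hyc).add hc) (hys n) hy
      (Eventually.of_forall fun s hs => by
        have e : As n s (ys n s) + cs n s - (A s (y s) + c s) =
            As n s (ys n s - y s) + ((As n s - A s) (y s) + (cs n s - c s)) := by
          rw [map_sub, sub_apply]
          abel
        simp only [Pi.add_apply]
        rw [e]
        refine (norm_add_le _ _).trans (add_le_add ((As n s).le_opNorm _)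
          ((norm_add_le _ _).trans (add_le_add ?_ le_rfl)))
        rw [mul_comm]
        exact (As n s - A s).le_opNorm_of_le (hR s hs)) t ht
    have h2 : ∫ s in Icc a b, (R * ‖As n s - A s‖ + ‖cs n s - c s‖) =
        R * (∫ s in Icc a b, ‖As n s - A s‖) + ∫ s in Icc a b, ‖cs n s - c s‖ := by
      rw [integral_add ((hAi n).const_mul R) (hci n), integral_const_mul]
    have h3 : ∫ s in Icc a b, ‖As n s‖ ≤
        (∫ s in Icc a b, ‖A s‖) + ∫ s in Icc a b, ‖As n s - A s‖ := by
      rw [← integral_add hA.norm (hAi n)]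
      refine integral_mono (hAs n).norm (hA.norm.add (hAi n)) fun s => ?_
      have := norm_le_norm_add_norm_sub (A s) (As n s)
      rwa [norm_sub_rev] at this
    have h4 : 0 ≤ ∫ s in Icc a b, ‖As n s - A s‖ := integral_nonneg fun _ => norm_nonneg _
    have h5 : 0 ≤ ∫ s in Icc a b, ‖cs n s - c s‖ := integral_nonneg fun _ => norm_nonneg _
    refine h1.trans ?_
    simp only [Pi.add_apply]
    rw [h2]
    gcongr
  refine tendstoUniformlyOn_of_norm_sub_le hbound ?_
  have h1 := (((tendsto_iff_norm_sub_tendsto_zero.1 hy₀).add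
    ((hAl.const_mul R).add hcl)).const_mul 2).mul
    ((Real.continuous_exp.tendsto _).comp ((hAl.const_add (∫ s in Icc a b, ‖A s‖)).const_mul 2))
  simpa using h1

end Linear

/-! ### The triangular system -/

section Triangular

variable {N : ℕ} {p : ℝ} {f : ℝ → V N → V N} {F : ℝ → V N → V N →L[ℝ] V N} {h : ℝ → V N → V N}
  {x₀ y₀ : V N} {J : Set ℝ}

theorem IsSolution.prodMk_triangular {x y : ℝ → V N} (hx : IsSolution f x₀ J x)
    (hyc : ContinuousOn y J)
    (hyi : ∀ t ∈ J, IntervalIntegrable (fun s => F s (x s) (y s) + h s (x s)) volume 0 t)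
    (hy : ∀ t ∈ J, y t = y₀ + ∫ s in (0 : ℝ)..t, (F s (x s) (y s) + h s (x s))) :
    IsSolution (triangular f F h) (x₀, y₀) J fun t => (x t, y t) where
  isOpen := hx.isOpen
  ordConnected := hx.ordConnected
  zero_mem := hx.zero_mem
  continuousOn := hx.continuousOn.prodMk hyc
  integrable t ht := ⟨(hx.integrable t ht).1.prodMk (hyi t ht).1,
    (hx.integrable t ht).2.prodMk (hyi t ht).2⟩
  eq t ht := by
    have hi : IntervalIntegrable (fun s => triangular f F h s (x s, y s)) volume 0 t :=
      ⟨(hx.integrable t ht).1.prodMk (hyi t ht).1, (hx.integrable t ht).2.prodMk (hyi t ht).2⟩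
    have h1 := (ContinuousLinearMap.fst ℝ (V N) (V N)).intervalIntegral_comp_comm hi
    have h2 := (ContinuousLinearMap.snd ℝ (V N) (V N)).intervalIntegral_comp_comm hi
    refine Prod.ext ?_ ?_
    · exact (hx.eq t ht).trans (congrArg (x₀ + ·) h1)
    · exact (hy t ht).trans (congrArg (y₀ + ·) h2)

theorem IsSolution.fst_triangular {z : ℝ → V N × V N}
    (hz : IsSolution (triangular f F h) (x₀, y₀) J z) : IsSolution f x₀ J fun t => (z t).1 where
  isOpen := hz.isOpen
  ordConnected := hz.ordConnected
  zero_mem := hz.zero_mem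
  continuousOn := hz.continuousOn.fst
  integrable t ht := ⟨(hz.integrable t ht).1.fst, (hz.integrable t ht).2.fst⟩
  eq t ht := by
    have h1 := (ContinuousLinearMap.fst ℝ (V N) (V N)).intervalIntegral_comp_comm
      (hz.integrable t ht)
    exact (congrArg Prod.fst (hz.eq t ht)).trans (congrArg (x₀ + ·) h1.symm)

theorem IsSolution.snd_triangular_eq {z : ℝ → V N × V N}
    (hz : IsSolution (triangular f F h) (x₀, y₀) J z) {t : ℝ} (ht : t ∈ J) :
    (z t).2 = y₀ + ∫ s in (0 : ℝ)..t, (F s (z s).1 (z s).2 + h s (z s).1) := by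
  have h1 := (ContinuousLinearMap.snd ℝ (V N) (V N)).intervalIntegral_comp_comm
    (hz.integrable t ht)
  exact (congrArg Prod.snd (hz.eq t ht)).trans (congrArg (y₀ + ·) h1.symm)

/-- `F` and `h` need not be Lipschitz in `x`: the first components agree because `f` is Lipschitz,
and then the second components solve one and the same linear equation. -/
theorem hasUniqueSolutions_triangular (hp : 1 ≤ p) (hf : f ∈ LC p N (V N)) (hF : IsC p F)
    (hh : IsC p h) : HasUniqueSolutions (triangular f F h) (x₀, y₀) := by
  intro J J' z z' hz hz' t ht
  have hx := hasUniqueSolutions_of_mem_LC hp hf x₀ hz.fst_triangular hz'.fst_triangular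
  refine Prod.ext (hx ht) ?_
  have hI : Icc (min 0 t) (max 0 t) ⊆ J ∩ J' :=
    (hz.ordConnected.inter hz'.ordConnected).uIcc_subset ⟨hz.zero_mem, hz'.zero_mem⟩ ht
  have hc := hz.continuousOn.mono (hI.trans inter_subset_left)
  have hc' := hz'.continuousOn.mono (hI.trans inter_subset_right)
  have hFi := hF.integrableOn_comp hp hc.fst
  have hhi := hh.integrableOn_comp hp hc.fst
  have key := norm_sub_le_of_integral_eq (x₀ := y₀) (x₀' := y₀) (min_le_left 0 t)
    (le_max_left 0 t) hFi.norm (fun _ => norm_nonneg _) (r := fun _ => 0) integrableOn_zero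
    (fun _ => le_rfl) hc.snd hc'.snd ((integrableOn_clm_apply hFi hc.snd).add hhi)
    ((integrableOn_clm_apply hFi hc'.snd).add hhi)
    (fun s hs => hz.snd_triangular_eq (hI hs).1)
    (fun s hs => by
      rw [hz'.snd_triangular_eq (hI hs).2]
      congr 1
      refine intervalIntegral.integral_congr fun u hu => ?_
      have hu' := (ordConnected_Icc.uIcc_subset ⟨min_le_left 0 t, le_max_left 0 t⟩ hs) hu
      have := hx (hI hu')
      simp only [Pi.add_apply] at this ⊢
      rw [this])
    (Eventually.of_forall fun s _ => by
      simp only [Pi.add_apply]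
      rw [add_sub_add_right_eq_sub, ← map_sub, add_zero]
      exact ContinuousLinearMap.le_opNorm _ _) t ⟨min_le_right _ _, le_max_right _ _⟩
  simpa [sub_eq_zero] using key

end Triangular

/-! ### Convergence of the coefficients along converging curves -/

/-- Convergence in `T_Θ` and condition (T) together: `Fₙ(·, zₙ) → F(·, z)` in `L^1` when `zₙ → z`
uniformly within `K_j^I`. -/
theorem tendsto_integral_norm_sub_of_tendsto {N : ℕ} {p : ℝ} (hp : 1 ≤ p) {Y : Type*}
    [NormedAddCommGroup Y] [MeasurableSpace Y] [OpensMeasurableSpace Y]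
    [SecondCountableTopology Y] {Θ : Moduli} {Fs : ℕ → ThetaC p Θ N Y} {F : ThetaC p Θ N Y}
    (hF : Tendsto Fs atTop (@nhds _ (TTheta p Θ _) F)) {j : ℕ} {q₁ q₂ : ℚ} (hq : q₁ ≤ q₂)
    {zs : ℕ → ℝ → V N} {z : ℝ → V N} (hzs : ∀ n, zs n ∈ KSet Θ j q₁ q₂)
    (hz : TendstoUniformlyOn zs z atTop (Icc (q₁ : ℝ) q₂)) :
    Tendsto (fun n => ∫ t in Icc (q₁ : ℝ) q₂, ‖(Fs n).1 t (zs n t) - F.1 t (z t)‖) atTop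
      (𝓝 0) := by
  have hzK := mem_KSet_of_tendstoUniformlyOn hzs hz
  have h1 := tendsto_integral_norm_sub_of_tendsto_thetaSeminorm hp (fun n => (Fs n).2.1) F.2.1
    (tendsto_thetaSeminorm_sub hp hF j hq) hzs
  have h2 := tendsto_integral_norm_sub_of_mem_ThetaC hp hq F.2 hzs hzK hz
  have h3 := h1.add h2
  rw [add_zero] at h3
  refine squeeze_zero (fun n => integral_nonneg fun _ => norm_nonneg _) (fun n => ?_) h3
  have i1 := (Fs n).2.1.integrableOn_comp hp (hzs n).1
  have i2 := F.2.1.integrableOn_comp hp (hzs n).1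
  have i3 := F.2.1.integrableOn_comp hp hzK.1
  refine le_of_le_of_eq ?_ (integral_add (i1.sub i2).norm (i2.sub i3).norm)
  exact integral_mono (i1.sub i3).norm ((i1.sub i2).norm.add (i2.sub i3).norm) fun s =>
    norm_sub_le_norm_sub_add_norm_sub _ _ _

end Caratheodory

/-! ### Continuous dependence of the solutions -/

open Caratheodory in
theorem mainTheorem1 (N : ℕ) (p : ℝ) (hp : 1 ≤ p)
    (E : Set (ℝ → V N → V N)) (hELC : E ⊆ LC p N (V N)) (hE : HasEquicontMBounds E)
    (fs : ℕ → LC p N (V N)) (hfs : ∀ n, (fs n).1 ∈ E) (f : LC p N (V N))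
    (hf : Tendsto fs atTop (@nhds _ (TTheta p (moduliOf E hE) (LC p N (V N))) f))
    (x₀s : ℕ → V N) (x₀ : V N) (hx₀ : Tendsto x₀s atTop (𝓝 x₀)) :
    (∀ T₁ T₂ : ℝ, Icc T₁ T₂ ⊆ maxInterval f.1 x₀ →
      (∀ᶠ n in atTop, Icc T₁ T₂ ⊆ maxInterval (fs n).1 (x₀s n)) ∧
      TendstoUniformlyOn (fun n => solution (fs n).1 (x₀s n)) (solution f.1 x₀) atTop
        (Icc T₁ T₂)) ∧
    (∀ (Fs : ℕ → ThetaC p (moduliOf E hE) N (V N →L[ℝ] V N))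
      (F : ThetaC p (moduliOf E hE) N (V N →L[ℝ] V N))
      (hs : ℕ → ThetaC p (moduliOf E hE) N (V N)) (h : ThetaC p (moduliOf E hE) N (V N))
      (y₀s : ℕ → V N) (y₀ : V N),
      Tendsto Fs atTop (@nhds _ (TTheta p (moduliOf E hE) _) F) →
      Tendsto hs atTop (@nhds _ (TTheta p (moduliOf E hE) _) h) →
      Tendsto y₀s atTop (𝓝 y₀) →
      ∀ T₁ T₂ : ℝ, Icc T₁ T₂ ⊆ maxInterval f.1 x₀ →
        Icc T₁ T₂ ⊆ maxInterval (triangular f.1 F.1 h.1) (x₀, y₀) ∧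
        (∀ᶠ n in atTop,
          Icc T₁ T₂ ⊆ maxInterval (triangular (fs n).1 (Fs n).1 (hs n).1) (x₀s n, y₀s n)) ∧
        TendstoUniformlyOn
          (fun n t => (solution (triangular (fs n).1 (Fs n).1 (hs n).1) (x₀s n, y₀s n) t).2)
          (fun t => (solution (triangular f.1 F.1 h.1) (x₀, y₀) t).2) atTop (Icc T₁ T₂)) := by
  refine ⟨fun T₁ T₂ hT => ?_, fun Fs F hs h y₀s y₀ hF hh hy₀ T₁ T₂ hT => ?_⟩
  · rcases lt_or_ge T₂ T₁ with hlt | hle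
    · simp [Icc_eq_empty_of_lt hlt, tendstoUniformlyOn_empty]
    have hsol := isSolution_solution (hasUniqueSolutions_of_mem_LC hp f.2 x₀)
      ⟨T₁, hT (left_mem_Icc.2 hle)⟩
    obtain ⟨q₁, q₂, hq₁, hq₂, hq, hTq⟩ := exists_rat_Icc_subset hsol.isOpen hsol.ordConnected
      hsol.zero_mem hle hT
    obtain ⟨j, zs, -, hz, hzsol⟩ := exists_projected_solutions hp hE hfs hf hx₀ hq₁ hq₂ hq
    refine ⟨hzsol.mono fun n hn => hTq.trans hn.subset_maxInterval,
      (hz.mono (hTq.trans Ioo_subset_Icc_self)).congr ?_⟩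
    exact hzsol.mono fun n hn t ht =>
      (hn.solution_eq (hasUniqueSolutions_of_mem_LC hp (fs n).2 _) (hTq ht)).symm
  · rcases lt_or_ge T₂ T₁ with hlt | hle
    · simp [Icc_eq_empty_of_lt hlt, tendstoUniformlyOn_empty]
    have hsol := isSolution_solution (hasUniqueSolutions_of_mem_LC hp f.2 x₀)
      ⟨T₁, hT (left_mem_Icc.2 hle)⟩
    obtain ⟨q₁, q₂, hq₁, hq₂, hq, hTq⟩ := exists_rat_Icc_subset hsol.isOpen hsol.ordConnected
      hsol.zero_mem hle hT
    have hq₁₂ : q₁ ≤ q₂ := by exact_mod_cast (hq₁.trans hq₂).le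
    obtain ⟨j, zs, hzK, hz, hzsol⟩ := exists_projected_solutions hp hE hfs hf hx₀ hq₁ hq₂ hq
    have hxc : ContinuousOn (solution f.1 x₀) (Icc (q₁ : ℝ) q₂) := hsol.continuousOn.mono hq
    have hx : IsSolution f.1 x₀ (Ioo (q₁ : ℝ) q₂) (solution f.1 x₀) :=
      isSolution_Ioo hq₁ hq₂ hxc (f.2.1.integrableOn_comp hp hxc) fun t ht => hsol.eq t (hq ht)
    have hA := F.2.1.integrableOn_comp hp hxc
    have hc := h.2.1.integrableOn_comp hp hxc
    have hAs := fun n => (Fs n).2.1.integrableOn_comp hp (hzK n).1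
    have hcs := fun n => (hs n).2.1.integrableOn_comp hp (hzK n).1
    obtain ⟨y, hyc, hy⟩ := exists_linear_solution hq₁.le hq₂.le hA hc y₀
    -- The linear equations are posed along the projected curves, which exist for every `n`.
    choose ys hysc hys using fun n =>
      exists_linear_solution hq₁.le hq₂.le (hAs n) (hcs n) (y₀s n)
    have hyl := tendstoUniformlyOn_linear hq₁.le hq₂.le hAs hA hcs hc
      (tendsto_integral_norm_sub_of_tendsto hp hF hq₁₂ hzK hz)
      (tendsto_integral_norm_sub_of_tendsto hp hh hq₁₂ hzK hz) hy₀
      (fun n => (hysc n).continuousOn) hyc.continuousOn hys hy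
    have h0 : (0 : ℝ) ∈ Icc (q₁ : ℝ) q₂ := ⟨hq₁.le, hq₂.le⟩
    have hxy : IsSolution (triangular f.1 F.1 h.1) (x₀, y₀) (Ioo (q₁ : ℝ) q₂)
        fun t => (solution f.1 x₀ t, y t) :=
      hx.prodMk_triangular hyc.continuousOn
        (fun t ht => ((integrableOn_clm_apply hA hyc.continuousOn).add
          hc).intervalIntegrable_of_mem h0 (Ioo_subset_Icc_self ht))
        fun t ht => hy t (Ioo_subset_Icc_self ht)
    have hxys : ∀ᶠ n in atTop, IsSolution (triangular (fs n).1 (Fs n).1 (hs n).1)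
        (x₀s n, y₀s n) (Ioo (q₁ : ℝ) q₂) fun t => (zs n t, ys n t) :=
      hzsol.mono fun n hn => hn.prodMk_triangular (hysc n).continuousOn
        (fun t ht => ((integrableOn_clm_apply (hAs n) (hysc n).continuousOn).add
          (hcs n)).intervalIntegrable_of_mem h0 (Ioo_subset_Icc_self ht))
        fun t ht => hys n t (Ioo_subset_Icc_self ht)
    refine ⟨hTq.trans hxy.subset_maxInterval,
      hxys.mono fun n hn => hTq.trans hn.subset_maxInterval, ?_⟩
    refine ((hyl.mono (hTq.trans Ioo_subset_Icc_self)).congr ?_).congr_right fun t ht => ?_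
    · exact hxys.mono fun n hn t ht => (congrArg Prod.snd (hn.solution_eq
        (hasUniqueSolutions_triangular hp (fs n).2 (Fs n).2.1 (hs n).2.1) (hTq ht))).symm
    · exact (congrArg Prod.snd (hxy.solution_eq
        (hasUniqueSolutions_triangular hp f.2 F.2.1 h.2.1) (hTq ht))).symm
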